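/- Let $L=\{+,\dotminus,\le,0,1,\tau\}$ and let $PresTOAG$ be the $L$-theory of Presburger truncated ordered abelian groups. It consists of the following axioms. (a) $\le$ is a linear order with least element $0$ and greatest element $\tau$; $+$ is commutative, associative and monotone in both arguments, with $x+0=x$ and $x+\tau=\tau$; if $x+y=x+z<\tau$ then $y=z$; if $x\le y<\tau$ then there is a unique $z$ with $x+z=y$, and $y\dotminus x$ is this $z$; $y\dotminus x=0$ if $y\le x$; if $x>0$ then $x+z=\tau$ for some $z<\tau$; $\tau\dotminus x=\min\{z: x+z=\tau\}$ and $\tau\dotminus(\tau\dotminus x)=x$; and the carry axioms: - if $x,y<\tau$ and $x+y=\tau$ then $y\dotminus(\tau\dotminus x)=x\dotminus(\tau\dotminus y)$; - if $y+z<\tau$, $x+(y+z)=\tau$ and $y+x<\tau$ then $x\dotminus(\tau\dotminus(y+z))=z\dotminus(\tau\dotminus(x+y))$; - if $y+z<\tau$, $x+(y+z)=\tau$, $x+y=\tau$ and $z+(y\dotminus(\tau\dotminus x))<\tau$ then $x\dotminus(\tau\dotminus(y+z))=z+(y\dotminus(\tau\dotminus x))$; - if $y+x=\tau$ and $y+z<\tau$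 then $z+(y\dotminus(\tau\dotminus x))<\tau$; - if $y+z=y+x=\tau$ and $z+(y\dotminus(\tau\dotminus x))<\tau$ then $x+(y\dotminus(\tau\dotminus z))=(x\dotminus(\tau\dotminus y))+z$; - if $y+z=y+x=\tau$ and $x+(y\dotminus(\tau\dotminus z))=\tau$ then $z+(y\dotminus(\tau\dotminus x))=\tau$; - if $y+z=y+x=x+(y\dotminus(\tau\dotminus z))=\tau$ then $(y\dotminus(\tau\dotminus x))\dotminus(\tau\dotminus z)=(y\dotminus(\tau\dotminus z))\dotminus(\tau\dotminus x)$. (b) $1$ is the least positive element, every element $<\tau$ has an immediate successor, and every positive element is an immediate successor. (c) For every $n\ge1$ and every $x$ there are $y$ and an integer $0\le m<n$ with $x=ny+m1$. Here $ny$ is $y+\dots+y$ ($n$ times). Say that $n\ge 1$ divides $d$ if $z\le d$ and $d\dotminus z=(n-1)z$ for some $z$ (that is, $d=nz$ without truncation), and write $x\equiv_n y$ if $n$ divides $(x\dotminus y)+(y\dotminus x)$. For integers $0\le m<q$, "$\tau\equiv m\pmod q$" is the sentence saying that $m1$ is not truncated (that is, $m=0$ or $(m-1)1<\tau$) and that $q$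 divides $\tau\dotminus m1$. For $f=(f(p))_p\in\hat{\mathbb Z}=\prod_p\mathbb Z_p$ let $C_f$ be the set of all sentences $\tau\equiv m\pmod{p^k}$, where $p$ is a prime, $k\ge1$, and $0\le m<p^k$ is the residue of $f(p)$ modulo $p^k$. A completion of $PresTOAG$ is a complete, deductively closed $L$-theory that contains $PresTOAG$. Then: 1. $PresTOAG$ is model complete: every embedding between two of its models is elementary. 2. $PresTOAG$ is consistent and not complete. For every $f\in\hat{\mathbb Z}$ the theory $PresTOAG\cup C_f$ together with the axioms saying that the universe is infinite is complete, and mapping $f$ to the set of consequences of this theory is a bijection from $\hat{\mathbb Z}$ onto the set of completions of $PresTOAG$ that have infinite models. If $f$ is not (the image of) a positive integer, then already $PresTOAG\cup C_f$ is complete. The other completions are the following: for each integer $n\ge1$ the theory $PresTOAG\cup\{(n-1)1<\tau,\ n1=\tau\}$ (that is, "$\tau=n$") is complete, and mapping $n$ to its set of consequences is a bijection from the positive integers onto the set of completions of $PresTOAG$ that have no infinite model. 3. In the language $L$ augmented by binary relation symbols $\equiv_n$, $n\ge2$, the theory $PresTOAG$ together with the above definitions of the $\equiv_n$ has quantifier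 elimination: every formula is equivalent, modulo the theory, to a quantifier-free formula in the same free variables. -/

import Mathlib

open FirstOrder FirstOrder.Language

universe u v

namespace TOAG

/-- Function symbols of the language of truncated ordered abelian groups with a constant for the
least positive element: constants `0`, `1`, `τ`, binary `+` and `∸`. -/
inductive ToagFunc : ℕ → Type
  | zero : ToagFunc 0
  | one : ToagFunc 0
  | tau : ToagFunc 0
  | add : ToagFunc 2
  | monus : ToagFunc 2

/-- The only relation symbol is the binary `≤`. -/
inductive ToagRel : ℕ → Type
  | le : ToagRel 2

/-- The first-order language `{+, ∸, ≤, 0, 1, τ}`. -/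
def toag : FirstOrder.Language.{0, 0} where
  Functions := ToagFunc
  Relations := ToagRel

instance : toag.IsOrdered := ⟨ToagRel.le⟩

section Terms

variable {α : Type*}

instance : Zero (toag.Term α) := ⟨Constants.term (L := toag) ToagFunc.zero⟩
instance : One (toag.Term α) := ⟨Constants.term (L := toag) ToagFunc.one⟩
instance : Add (toag.Term α) := ⟨Functions.apply₂ (L := toag) ToagFunc.add⟩

/-- The constant `τ` (the top element). -/
def tau : toag.Term α := Constants.term (L := toag) ToagFunc.tau

/-- The term `s ∸ t`. -/
def monus (s t : toag.Term α) : toag.Term α := Functions.apply₂ (L := toag) ToagFunc.monus s t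

/-- The term `t + ⋯ + t` (`n` summands). -/
def mult : ℕ → toag.Term α → toag.Term α
  | 0, _ => 0
  | n + 1, t => mult n t + t

end Terms

infixl:66 " ∸ " => monus

/-- Terms in the variables `x_0, …, x_{k-1}`. -/
abbrev Tm (k : ℕ) : Type := toag.Term (Empty ⊕ Fin k)

/-- The variable `x_i`. -/
abbrev x {k : ℕ} (i : Fin k) : Tm k := Term.var (Sum.inr i)

/-- The formula `s ≤ t`. -/
abbrev leF {k : ℕ} (s t : Tm k) : toag.BoundedFormula Empty k := Term.le s t

/-- The formula `s < t`. -/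
abbrev ltF {k : ℕ} (s t : Tm k) : toag.BoundedFormula Empty k := Term.lt s t

/-- The formula `s = t`. -/
abbrev eqF {k : ℕ} (s t : Tm k) : toag.BoundedFormula Empty k := Term.bdEqual s t

infix:88 " ≼ " => leF
infix:88 " ≺ " => ltF
infix:88 " ≐ " => eqF

/-! ### Axioms for truncated ordered abelian groups -/

/-- `0` is the least and `τ` the greatest element. -/
def axBounds : toag.Sentence := ∀' (0 ≼ x 0 ⊓ x 0 ≼ tau)

def axAddComm : toag.Sentence := ∀' ∀' ((x 0 + x 1) ≐ (x 1 + x 0))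

def axAddZeroTau : toag.Sentence := ∀' (((x 0 + 0) ≐ x 0) ⊓ ((x 0 + tau) ≐ tau))

def axAddMono : toag.Sentence :=
  ∀' ∀' ∀' ∀' ((x 0 ≼ x 1 ⊓ x 2 ≼ x 3) ⟹ (x 0 + x 2) ≼ (x 1 + x 3))

def axAddAssoc : toag.Sentence := ∀' ∀' ∀' ((x 0 + x 1 + x 2) ≐ (x 0 + (x 1 + x 2)))

/-- If `x + y = x + z < τ` then `y = z`. -/
def axCancel : toag.Sentence :=
  ∀' ∀' ∀' ((((x 0 + x 1) ≐ (x 0 + x 2)) ⊓ (x 0 + x 1) ≺ tau) ⟹ (x 1 ≐ x 2))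

/-- If `x ≤ y < τ` then there is a unique `z` with `x + z = y`. -/
def axDiff : toag.Sentence :=
  ∀' ∀' ((x 0 ≼ x 1 ⊓ x 1 ≺ tau) ⟹
    ∃' (((x 0 + x 2) ≐ x 1) ⊓ ∀' (((x 0 + x 3) ≐ x 1) ⟹ (x 3 ≐ x 2))))

/-- If `x ≤ y < τ` then `y ∸ x` is the element `z` with `x + z = y`. -/
def axMonusDiff : toag.Sentence :=
  ∀' ∀' ((x 0 ≼ x 1 ⊓ x 1 ≺ tau) ⟹ ((x 0 + (x 1 ∸ x 0)) ≐ x 1))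

/-- If `y ≤ x` then `y ∸ x = 0`. -/
def axMonusZero : toag.Sentence :=
  ∀' ∀' (x 1 ≼ x 0 ⟹ ((x 1 ∸ x 0) ≐ 0))

/-- If `0 < x` then there is `z < τ` with `x + z = τ`. -/
def axCompl : toag.Sentence :=
  ∀' (0 ≺ x 0 ⟹ ∃' (x 1 ≺ tau ⊓ ((x 0 + x 1) ≐ tau)))

/-- `τ ∸ x` is the least `z` with `x + z = τ`. -/
def axComplMin : toag.Sentence :=
  ∀' (((x 0 + (tau ∸ x 0)) ≐ tau) ⊓ ∀' (((x 0 + x 1) ≐ tau) ⟹ (tau ∸ x 0) ≼ x 1))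

def axComplCompl : toag.Sentence := ∀' ((tau ∸ (tau ∸ x 0)) ≐ x 0)

/-! In the next axioms `x, y, z` are the variables `x 0, x 1, x 2`. -/

/-- If `x, y < τ` and `x + y = τ` then `y ∸ (τ ∸ x) = x ∸ (τ ∸ y)`. -/
def axCarryComm : toag.Sentence :=
  ∀' ∀' ((x 0 ≺ tau ⊓ x 1 ≺ tau ⊓ ((x 0 + x 1) ≐ tau)) ⟹
    ((x 1 ∸ (tau ∸ x 0)) ≐ (x 0 ∸ (tau ∸ x 1))))

/-- If `y + z < τ`, `x + (y + z) = τ` and `y + x < τ` then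
`x ∸ (τ ∸ (y + z)) = z ∸ (τ ∸ (x + y))`. -/
def axCarryAssoc₁ : toag.Sentence :=
  ∀' ∀' ∀' (((x 1 + x 2) ≺ tau ⊓ ((x 0 + (x 1 + x 2)) ≐ tau) ⊓ (x 1 + x 0) ≺ tau) ⟹
    ((x 0 ∸ (tau ∸ (x 1 + x 2))) ≐ (x 2 ∸ (tau ∸ (x 0 + x 1)))))

/-- If `y + z < τ`, `x + (y + z) = τ`, `x + y = τ` and `z + (y ∸ (τ ∸ x)) < τ` then
`x ∸ (τ ∸ (y + z)) = z + (y ∸ (τ ∸ x))`. -/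
def axCarryAssoc₂ : toag.Sentence :=
  ∀' ∀' ∀' (((x 1 + x 2) ≺ tau ⊓ ((x 0 + (x 1 + x 2)) ≐ tau) ⊓ ((x 0 + x 1) ≐ tau) ⊓
      (x 2 + (x 1 ∸ (tau ∸ x 0))) ≺ tau) ⟹
    ((x 0 ∸ (tau ∸ (x 1 + x 2))) ≐ (x 2 + (x 1 ∸ (tau ∸ x 0)))))

/-- If `y + x = τ` and `y + z < τ` then `z + (y ∸ (τ ∸ x)) < τ`. -/
def axCarryLt : toag.Sentence :=
  ∀' ∀' ∀' ((((x 1 + x 0) ≐ tau) ⊓ (x 1 + x 2) ≺ tau) ⟹ (x 2 + (x 1 ∸ (tau ∸ x 0))) ≺ tau)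

/-- If `y + z = y + x = τ` and `z + (y ∸ (τ ∸ x)) < τ` then
`x + (y ∸ (τ ∸ z)) = (x ∸ (τ ∸ y)) + z`. -/
def axCarryAssoc₃ : toag.Sentence :=
  ∀' ∀' ∀' ((((x 1 + x 2) ≐ tau) ⊓ ((x 1 + x 0) ≐ tau) ⊓ (x 2 + (x 1 ∸ (tau ∸ x 0))) ≺ tau) ⟹
    ((x 0 + (x 1 ∸ (tau ∸ x 2))) ≐ ((x 0 ∸ (tau ∸ x 1)) + x 2)))

/-- If `y + z = y + x = τ` and `x + (y ∸ (τ ∸ z)) = τ` then `z + (y ∸ (τ ∸ x)) = τ`. -/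
def axCarryTau : toag.Sentence :=
  ∀' ∀' ∀' ((((x 1 + x 2) ≐ tau) ⊓ ((x 1 + x 0) ≐ tau) ⊓ ((x 0 + (x 1 ∸ (tau ∸ x 2))) ≐ tau)) ⟹
    ((x 2 + (x 1 ∸ (tau ∸ x 0))) ≐ tau))

/-- If `y + z = y + x = x + (y ∸ (τ ∸ z)) = τ` then
`(y ∸ (τ ∸ x)) ∸ (τ ∸ z) = (y ∸ (τ ∸ z)) ∸ (τ ∸ x)`. -/
def axCarryAssoc₄ : toag.Sentence :=
  ∀' ∀' ∀' ((((x 1 + x 2) ≐ tau) ⊓ ((x 1 + x 0) ≐ tau) ⊓ ((x 0 + (x 1 ∸ (tau ∸ x 2))) ≐ tau)) ⟹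
    ((x 1 ∸ (tau ∸ x 0) ∸ (tau ∸ x 2)) ≐ (x 1 ∸ (tau ∸ x 2) ∸ (tau ∸ x 0))))

/-- The theory of truncated ordered abelian groups. -/
def toagTheory : toag.Theory :=
  toag.linearOrderTheory ∪
  {axBounds, axAddComm, axAddZeroTau, axAddMono, axAddAssoc, axCancel, axDiff, axMonusDiff,
    axMonusZero, axCompl, axComplMin, axComplCompl, axCarryComm, axCarryAssoc₁, axCarryAssoc₂,
    axCarryLt, axCarryAssoc₃, axCarryTau, axCarryAssoc₄}

/-! ### Presburger axioms -/

/-- `1` is the least positive element. -/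
def axOne : toag.Sentence :=
  (0 ≺ 1) ⊓ ∀' (0 ≺ x 0 ⟹ 1 ≼ x 0)

/-- Every element other than `τ` has an immediate successor. -/
def axHasSucc : toag.Sentence :=
  ∀' (x 0 ≺ tau ⟹ ∃' (x 0 ≺ x 1 ⊓ ∀' (x 0 ≺ x 2 ⟹ x 1 ≼ x 2)))

/-- Every positive element is an immediate successor. -/
def axIsSucc : toag.Sentence :=
  ∀' (0 ≺ x 0 ⟹ ∃' (x 1 ≺ x 0 ⊓ ∀' (x 1 ≺ x 2 ⟹ x 0 ≼ x 2)))

/-- The remainder axiom for `n`: every `x` is `n y + m 1` for some `y` and some integer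
`0 ≤ m < n`. -/
noncomputable def axRemainder (n : ℕ) : toag.Sentence :=
  ∀' ∃' (BoundedFormula.iSup fun m : Fin n => (x 0 ≐ (mult n (x 1) + mult m 1)))

/-- The theory of Presburger truncated ordered abelian groups. -/
noncomputable def presTOAG : toag.Theory :=
  toagTheory ∪ {axOne, axHasSucc, axIsSucc} ∪ {φ | ∃ n : ℕ, 1 ≤ n ∧ φ = axRemainder n}

/-! ### Congruences -/

/-- For `n ≥ 1`: `d = n z` as an untruncated sum. This is written as `d - z = (n - 1) z` with
`z ≤ d`, which cannot hold through truncation: if `(n - 1) z` is truncated to `τ`, then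
`d ∸ z = τ` forces `d = τ` and `z = 0`, hence `τ = 0`. -/
def isMultiple {k : ℕ} (n : ℕ) (d z : Tm k) : toag.BoundedFormula Empty k :=
  z ≼ d ⊓ (mult (n - 1) z ≐ (d ∸ z))

/-- For `n ≥ 1`: the elements `x 0` and `x 1` are congruent modulo `n`, that is, their
distance `(x 0 ∸ x 1) + (x 1 ∸ x 0)` (one of the two summands is `0`) is `n z` for some `z`. -/
def congruent (n : ℕ) : toag.BoundedFormula Empty 2 :=
  ∃' isMultiple n ((x 0 ∸ x 1) + (x 1 ∸ x 0)) (x 2)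

/-- For `0 ≤ m < q`: `τ ≡ m (mod q)`, that is, `τ - m = q z` for some `z`. The first conjunct says
that `m ≤ τ`, so that the term `m 1` is not truncated (it is `0 < τ` if `m = 0`). -/
def tauResidue (q m : ℕ) : toag.Sentence :=
  mult (m - 1) 1 ≺ tau ⊓ ∃' isMultiple q (tau ∸ mult m 1) (x 0)

/-- For `n ≥ 1`: `τ` is exactly `n`, that is, `(n - 1) 1 < τ` and `n 1 = τ`. -/
def tauEq (n : ℕ) : toag.Sentence :=
  mult (n - 1) 1 ≺ tau ⊓ (mult n 1 ≐ tau)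

instance (p : Nat.Primes) : Fact (p : ℕ).Prime := ⟨p.2⟩

/-- The ring of profinite integers, as the product of the rings of `p`-adic integers. -/
abbrev ZHat : Type := ∀ p : Nat.Primes, ℤ_[(p : ℕ)]

/-- The axioms `τ ≡ f(p) (mod p ^ k)` for all primes `p` and all `k ≥ 1`. -/
noncomputable def residueAxioms (f : ZHat) : toag.Theory :=
  {φ | ∃ (p : Nat.Primes) (k : ℕ), 1 ≤ k ∧
    φ = tauResidue ((p : ℕ) ^ k) (PadicInt.toZModPow k (f p)).val}

/-! ### The language with congruences -/

/-- The relation symbols `≡_n`, `n ≥ 2`, all binary. -/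
inductive CongRel : ℕ → Type
  | cong (n : ℕ) (hn : 2 ≤ n) : CongRel 2

/-- The language of truncated ordered abelian groups augmented by the relations `≡_n`, `n ≥ 2`. -/
def toagCong : FirstOrder.Language.{0, 0} := toag.sum ⟨fun _ => Empty, CongRel⟩

/-- The inclusion of languages. -/
def toagIncl : toag →ᴸ toagCong := LHom.sumInl

/-- The symbol `≡_n`. -/
def congSymb (n : ℕ) (hn : 2 ≤ n) : toagCong.Relations 2 := Sum.inr (CongRel.cong n hn)

/-- The defining axiom of `≡_n`. -/
def axCong (n : ℕ) (hn : 2 ≤ n) : toagCong.Sentence :=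
  ∀' ∀' (((congSymb n hn).boundedFormula₂ &0 &1) ⇔ toagIncl.onBoundedFormula (congruent n))

/-- The theory of Presburger truncated ordered abelian groups in the augmented language. -/
noncomputable def presTOAGCong : toagCong.Theory :=
  toagIncl.onTheory presTOAG ∪ {φ | ∃ (n : ℕ) (hn : 2 ≤ n), φ = axCong n hn}

/-! ### Model-theoretic notions -/

/-- A theory is model complete if every embedding between models is elementary. -/
def IsModelComplete {L : FirstOrder.Language.{0, 0}} (T : L.Theory) : Prop :=
  ∀ (M : Type u) (N : Type v) [L.Structure M] [L.Structure N], M ⊨ T → N ⊨ T →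
    ∀ f : M ↪[L] N, ∃ g : M ↪ₑ[L] N, ∀ x, g x = f x

/-- A theory has quantifier elimination if every formula is equivalent, modulo the theory, to a
quantifier-free one in the same free variables. -/
def HasQE {L : FirstOrder.Language.{0, 0}} (T : L.Theory) : Prop :=
  ∀ (n : ℕ) (φ : L.Formula (Fin n)), ∃ ψ : L.Formula (Fin n),
    BoundedFormula.IsQF ψ ∧ T ⊨ᵇ BoundedFormula.iff φ ψ

/-- The deductive closure of a theory. -/
def consequences {L : FirstOrder.Language.{0, 0}} (T : L.Theory) : L.Theory := {φ | T ⊨ᵇ φ}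

/-- The complete (deductively closed) extensions of a theory in the same language. -/
def completions {L : FirstOrder.Language.{0, 0}} (T : L.Theory) : Set L.Theory :=
  {T' | T ⊆ T' ∧ T'.IsMaximal}

end TOAG

/-!
A truncated ordered abelian group is the interval from `0` to `τ` in the ordered abelian group that
it generates, whose elements are uniquely `k τ + x` with `k ∈ ℤ` and `x < τ`; the carry axioms are
the associativity and commutativity of addition there. For models of `presTOAG` this group is a
`ℤ`-group with least positive element `1`.

A formula of bounded depth only sees, of a tuple in `[0, τ]`, the signs of the integer linear forms
of bounded length in the tuple, `1` and `τ`, and the residues of the tuple and of `τ` for bounded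
moduli: if these agree for two tuples, then they can be kept in agreement, with smaller bounds,
while the tuples are extended by one entry in either model. Embeddings preserve all these data,
whence model completeness. The data are determined by finitely many atomic formulas, whence
quantifier elimination. For the empty tuple they only depend on the residues of `τ` if `τ` exceeds
every multiple of `1`, and `τ` is a multiple of `1` otherwise, whence the list of completions. Any
finitely many residues are realised by arbitrarily long intervals `{0, …, n}` of integers, by the
Chinese remainder theorem, so compactness gives an infinite model for each family of residues.
-/

namespace TOAG

universe w

open scoped Pointwise

/-! ### Residues modulo multiples -/

section Residues

variable {P Q : Type*} [AddCommGroup P] [AddCommGroup Q] {u p : P} {a b m n : ℕ}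

/-- The elements of `P` that are congruent to an integer multiple of `u` modulo `n`. In a product
`G × H` with `u = (1, 1)`, membership of `(a, b)` says that `a` and `b` have a common integer
residue modulo `n`. -/
def residueSubgroup (u : P) (n : ℕ) : AddSubgroup P :=
  AddSubgroup.zmultiples u ⊔ (nsmulAddMonoidHom n).range

theorem mem_residueSubgroup :
    p ∈ residueSubgroup u n ↔ ∃ (r : ℤ) (h : P), p = r • u + n • h := by
  rw [residueSubgroup, AddSubgroup.mem_sup]
  constructor
  · rintro ⟨_, ⟨r, rfl⟩, _, ⟨h, rfl⟩, rfl⟩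
    exact ⟨r, h, rfl⟩
  · rintro ⟨r, h, rfl⟩
    exact ⟨_, ⟨r, rfl⟩, _, ⟨h, rfl⟩, rfl⟩

theorem self_mem_residueSubgroup : u ∈ residueSubgroup u n :=
  AddSubgroup.mem_sup_left (AddSubgroup.mem_zmultiples u)

theorem nsmul_mem_residueSubgroup (h : P) : n • h ∈ residueSubgroup u n :=
  AddSubgroup.mem_sup_right ⟨h, rfl⟩

theorem residueSubgroup_le_of_dvd (hmn : m ∣ n) : residueSubgroup u n ≤ residueSubgroup u m := by
  obtain ⟨k, rfl⟩ := hmn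
  refine sup_le_sup_left ?_ _
  rintro _ ⟨h, rfl⟩
  exact ⟨k • h, (mul_smul m k h).symm⟩

theorem map_mem_residueSubgroup (f : P →+ Q) (hp : p ∈ residueSubgroup u n) :
    f p ∈ residueSubgroup (f u) n := by
  obtain ⟨r, h, rfl⟩ := mem_residueSubgroup.1 hp
  exact mem_residueSubgroup.2 ⟨r, f h, by simp only [map_add, map_zsmul, map_nsmul]⟩

theorem nsmul_mem_residueSubgroup_mul (a : ℕ) (hp : p ∈ residueSubgroup u b) :
    a • p ∈ residueSubgroup u (a * b) := by
  obtain ⟨r, h, rfl⟩ := mem_residueSubgroup.1 hp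
  exact mem_residueSubgroup.2 ⟨a * r, h, by rw [smul_add, mul_smul, mul_smul, natCast_zsmul]⟩

theorem mem_residueSubgroup_mul_of_coprime (hab : a.Coprime b) (ha : p ∈ residueSubgroup u a)
    (hb : p ∈ residueSubgroup u b) : p ∈ residueSubgroup u (a * b) := by
  have bezout : p = a.gcdA b • a • p + a.gcdB b • b • p := by
    rw [← natCast_zsmul p, ← natCast_zsmul p, smul_smul, smul_smul, ← add_smul,
      mul_comm (a.gcdA b), mul_comm (a.gcdB b), ← Nat.gcd_eq_gcd_ab, hab.gcd_eq_one, Nat.cast_one,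
      one_smul]
  have ha' : b • p ∈ residueSubgroup u (a * b) := mul_comm b a ▸ nsmul_mem_residueSubgroup_mul b ha
  rw [bezout]
  exact add_mem (zsmul_mem (nsmul_mem_residueSubgroup_mul a hb) _) (zsmul_mem ha' _)

end Residues

/-- `u` is the least positive element of `G`, and the integer multiples of `u` represent all
classes modulo every positive integer: `(G, u)` is a model of Presburger arithmetic. -/
structure IsPresburgerUnit {G : Type*} [AddCommGroup G] [LinearOrder G] (u : G) : Prop where
  pos : 0 < u
  le_of_pos : ∀ g, 0 < g → u ≤ g
  residueSubgroup_eq_top : ∀ n : ℕ, 0 < n → residueSubgroup u n = ⊤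

namespace IsPresburgerUnit

variable {G : Type*} [AddCommGroup G] [LinearOrder G] {u : G}

theorem exists_eq_zsmul_add_nsmul (hu : IsPresburgerUnit u) {n : ℕ} (hn : 0 < n) (g : G) :
    ∃ (r : ℤ) (h : G), g = r • u + n • h :=
  mem_residueSubgroup.1 (hu.residueSubgroup_eq_top n hn ▸ AddSubgroup.mem_top g)

theorem exists_lt_eq_nsmul_add_nsmul (hu : IsPresburgerUnit u) {n : ℕ} (hn : 0 < n) (g : G) :
    ∃ r < n, ∃ h : G, g = r • u + n • h := by
  obtain ⟨r, h, rfl⟩ := hu.exists_eq_zsmul_add_nsmul hn g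
  have hn' : (0 : ℤ) < n := by exact_mod_cast hn
  obtain ⟨s, hs⟩ := Int.eq_ofNat_of_zero_le (Int.emod_nonneg r hn'.ne')
  refine ⟨s, by have := Int.emod_lt_of_pos r hn'; omega, (r / n) • u + h, ?_⟩
  rw [nsmul_add, ← add_assoc, ← natCast_zsmul u s, ← natCast_zsmul ((r / n) • u) n, smul_smul,
    ← add_smul, ← hs, Int.emod_add_mul_ediv]

variable [IsOrderedAddMonoid G]

theorem exists_eq_nsmul_of_le (hu : IsPresburgerUnit u) {g : G} {J : ℕ} (h0 : 0 ≤ g)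
    (h1 : g ≤ J • u) : ∃ j ≤ J, g = j • u := by
  induction J with
  | zero => exact ⟨0, le_rfl, le_antisymm (by simpa only [zero_smul] using h1) (by simpa using h0)⟩
  | succ J ih =>
    rcases le_or_gt g (J • u) with h | h
    · obtain ⟨j, hj, rfl⟩ := ih h
      exact ⟨j, by omega, rfl⟩
    · refine ⟨J + 1, le_rfl, le_antisymm h1 ?_⟩
      rw [succ_nsmul']
      exact le_sub_iff_add_le.1 (hu.le_of_pos _ (sub_pos.2 h))

theorem dvd_of_zsmul_eq_nsmul (hu : IsPresburgerUnit u) {n : ℕ} (hn : 0 < n) {h : G} {r : ℤ}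
    (e : r • u = n • h) : (n : ℤ) ∣ r := by
  have hn' : (0 : ℤ) < n := by exact_mod_cast hn
  obtain ⟨k, hk⟩ : ∃ k : G, (r % n) • u = n • k := by
    refine ⟨h - (r / n) • u, ?_⟩
    rw [nsmul_sub, ← e, ← natCast_zsmul, smul_smul, ← sub_smul, Int.emod_def]
  have k_nonpos : k ≤ 0 := by
    by_contra hk0
    have : n • u ≤ n • k := nsmul_le_nsmul_right (hu.le_of_pos k (not_le.1 hk0)) n
    rw [← hk, ← natCast_zsmul, zsmul_le_zsmul_iff_left hu.pos] at this
    exact (Int.emod_lt_of_pos r hn').not_ge this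
  have : (r % n) • u ≤ (0 : ℤ) • u := by
    rw [hk, zero_smul]
    exact nsmul_nonpos k_nonpos n
  rw [zsmul_le_zsmul_iff_left hu.pos] at this
  exact Int.dvd_of_emod_eq_zero (this.antisymm (Int.emod_nonneg r hn'.ne'))

theorem intCast_eq_of_zsmul_add_eq (hu : IsPresburgerUnit u) {n : ℕ} (hn : 0 < n) {r s : ℤ}
    {h k : G}
    (e : r • u + n • h = s • u + n • k) : (r : ZMod n) = s := by
  rw [ZMod.intCast_eq_intCast_iff_dvd_sub]
  refine hu.dvd_of_zsmul_eq_nsmul hn (h := h - k) ?_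
  rw [sub_smul, smul_sub, sub_eq_sub_iff_add_eq_add, ← e, add_comm]

theorem exists_padicInt (hu : IsPresburgerUnit u) (p : ℕ) [Fact p.Prime] (g : G) :
    ∃ x : ℤ_[p], ∀ k, ∃ h : G, g = (PadicInt.toZModPow k x).val • u + p ^ k • h := by
  have p_pow_pos (k : ℕ) : 0 < p ^ k := pow_pos (Fact.out : p.Prime).pos k
  choose r hr h e using fun k => hu.exists_lt_eq_nsmul_add_nsmul (p_pow_pos k) g
  have dvd_sub (k : ℕ) : (p : ℤ) ^ k ∣ (r (k + 1) : ℤ) - r k := by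
    rw [← Nat.cast_pow, ← ZMod.intCast_eq_intCast_iff_dvd_sub]
    refine hu.intCast_eq_of_zsmul_add_eq (p_pow_pos k) (h := h k) (k := p • h (k + 1)) ?_
    rw [natCast_zsmul, natCast_zsmul, smul_smul, ← pow_succ, ← e k, ← e (k + 1)]
  refine ⟨PadicInt.ofIntSeq _
    (PadicInt.isCauSeq_padicNorm_of_pow_dvd_sub (fun k => (r k : ℤ)) p dvd_sub), fun k => ⟨h k, ?_⟩⟩
  rw [PadicInt.toZModPow_ofIntSeq_of_pow_dvd_sub (fun k => (r k : ℤ)) p dvd_sub, Int.cast_natCast,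
    ZMod.val_cast_of_lt (hr k)]
  exact e k

theorem exists_nsmul_mem_Ioc (hu : IsPresburgerUnit u) {K : ℕ} (hK : 0 < K) (r : ℤ) (g : G) :
    ∃ c : G, K • (r • u + K • c) ∈ Set.Ioc g (g + (K * K) • u) := by
  obtain ⟨s, hs, q, e⟩ := hu.exists_lt_eq_nsmul_add_nsmul (Nat.mul_pos hK hK) (g - K • r • u)
  have key : K • (r • u + K • (q + u)) = g + ((K * K) • u - s • u) := by
    rw [nsmul_add, smul_smul, nsmul_add, eq_sub_of_add_eq' e.symm]
    abel
  refine ⟨q + u, ?_, ?_⟩ <;> rw [key]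
  · exact lt_add_of_pos_right g (sub_pos.2 (nsmul_lt_nsmul_left hu.pos hs))
  · exact add_le_add_right (sub_le_self _ (nsmul_nonneg hu.pos.le s)) g

end IsPresburgerUnit

/-! ### Similarity of tuples in two ordered groups -/

section Ball

variable {P Q : Type*} [AddCommGroup P] [AddCommGroup Q] {X Y : Set P} {p q : P} {M N : ℕ}

/-- The sums of `N` elements of `X ∪ -X ∪ {0}`: the values at `X` of the integer linear forms with
coefficients of total size at most `N`. -/
def ball (X : Set P) : ℕ → Set P
  | 0 => {0}
  | N + 1 => ball X N + insert 0 (X ∪ -X)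

theorem zero_mem_ball (X : Set P) (N : ℕ) : (0 : P) ∈ ball X N := by
  induction N with
  | zero => rfl
  | succ N ih => exact ⟨0, ih, 0, Set.mem_insert 0 _, add_zero 0⟩

theorem ball_add (X : Set P) (M N : ℕ) : ball X (M + N) = ball X M + ball X N := by
  induction N with
  | zero => exact (add_zero (ball X M)).symm
  | succ N ih => rw [← Nat.add_assoc, ball, ball, ih, add_assoc]

theorem add_mem_ball (hp : p ∈ ball X M) (hq : q ∈ ball X N) : p + q ∈ ball X (M + N) :=
  ball_add X M N ▸ Set.add_mem_add hp hq

theorem ball_mono (h : M ≤ N) : ball X M ⊆ ball X N := by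
  obtain ⟨k, rfl⟩ := Nat.exists_eq_add_of_le h
  exact fun p hp => add_zero p ▸ add_mem_ball hp (zero_mem_ball X k)

theorem ball_subset_ball (h : X ⊆ Y) : ball X N ⊆ ball Y N := by
  induction N with
  | zero => exact le_rfl
  | succ N ih =>
    exact Set.add_subset_add ih
      (Set.insert_subset_insert (Set.union_subset_union h (Set.neg_subset_neg.2 h)))

theorem neg_ball (X : Set P) (N : ℕ) : -ball X N = ball X N := by
  induction N with
  | zero => simp only [ball, Set.neg_singleton, neg_zero]
  | succ N ih =>
    simp only [ball, neg_add, ih, Set.neg_insert, Set.union_neg, neg_neg, neg_zero, Set.union_comm]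

theorem neg_mem_ball (hp : p ∈ ball X N) : -p ∈ ball X N := by
  rwa [← neg_ball, Set.neg_mem_neg]

theorem sub_mem_ball (hp : p ∈ ball X M) (hq : q ∈ ball X N) : p - q ∈ ball X (M + N) :=
  sub_eq_add_neg p q ▸ add_mem_ball hp (neg_mem_ball hq)

theorem mem_ball_one (hp : p ∈ X) : p ∈ ball X 1 :=
  ⟨0, rfl, p, Or.inr (Or.inl hp), zero_add p⟩

theorem nsmul_mem_ball (k : ℕ) (hp : p ∈ ball X N) : k • p ∈ ball X (k * N) := by
  induction k with
  | zero => simpa only [zero_smul] using zero_mem_ball X _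
  | succ k ih => rw [succ_nsmul, Nat.succ_mul]; exact add_mem_ball ih hp

theorem nsmul_mem_ball_of_mem (k : ℕ) (hp : p ∈ X) : k • p ∈ ball X k := by
  simpa only [mul_one] using nsmul_mem_ball k (mem_ball_one hp)

theorem finite_ball (hX : X.Finite) (N : ℕ) : (ball X N).Finite := by
  induction N with
  | zero => exact Set.finite_singleton 0
  | succ N ih => exact ih.add ((hX.union hX.neg).insert 0)

theorem ball_subset_addSubgroup {S : AddSubgroup P} (hX : X ⊆ S) : ball X N ⊆ S := by
  induction N with
  | zero => exact Set.singleton_subset_iff.2 S.zero_mem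
  | succ N ih =>
    rintro _ ⟨q, hq, e, he, rfl⟩
    refine S.add_mem (ih hq) ?_
    rcases he with rfl | he | he
    · exact S.zero_mem
    · exact hX he
    · exact neg_neg e ▸ S.neg_mem (hX he)

theorem exists_eq_add_zsmul_of_mem_ball_insert {e : P} (hp : p ∈ ball (insert e X) N) :
    ∃ q ∈ ball X N, ∃ m : ℤ, |m| ≤ N ∧ p = q + m • e := by
  induction N generalizing p with
  | zero => exact ⟨0, rfl, 0, by simp, by simpa [ball] using hp⟩
  | succ N ih =>
    obtain ⟨_, hq', d, hd, rfl⟩ := hp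
    obtain ⟨q, hq, m, hm, rfl⟩ := ih hq'
    have hq_succ := ball_mono (Nat.le_succ N) hq
    push_cast
    rcases hd with rfl | (rfl | hd) | (hd | hd)
    · exact ⟨q, hq_succ, m, by omega, add_zero _⟩
    · exact ⟨q, hq_succ, m + 1, (abs_add_le m 1).trans (by simpa), by rw [add_one_zsmul, add_assoc]⟩
    · exact ⟨q + d, Set.add_mem_add hq (Or.inr (Or.inl hd)), m, by omega, add_right_comm _ _ _⟩
    · obtain rfl := neg_eq_iff_eq_neg.1 hd
      exact ⟨q, hq_succ, m - 1, (abs_sub m 1).trans (by simpa), by rw [sub_one_zsmul, add_assoc]⟩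
    · exact ⟨q + d, Set.add_mem_add hq (Or.inr (Or.inr hd)), m, by omega, add_right_comm _ _ _⟩

theorem map_mem_ball (f : P →+ Q) (hp : p ∈ ball X N) : f p ∈ ball (f '' X) N := by
  induction N generalizing p with
  | zero => obtain rfl : p = 0 := hp; exact map_zero f
  | succ N ih =>
    obtain ⟨q, hq, e, he, rfl⟩ := hp
    refine ⟨f q, ih hq, f e, ?_, (map_add f q e).symm⟩
    rcases he with rfl | he | he
    · exact Or.inl (map_zero f)
    · exact Or.inr (Or.inl ⟨e, he, rfl⟩)
    · exact Or.inr (Or.inr ⟨-e, he, map_neg f e⟩)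

end Ball

section OrderedGroup

variable {G : Type*} [AddCommGroup G] [LinearOrder G] [IsOrderedAddMonoid G] {g a : G} {m : ℤ}
  {c K : ℕ}

theorem nonneg_add_zsmul_iff_neg_le (hc : 0 < c) (h : c * m = K) :
    0 ≤ g + m • a ↔ -(c • g) ≤ K • a := by
  rw [← nsmul_nonneg_iff hc.ne', nsmul_add, ← natCast_zsmul (m • a), smul_smul, h, natCast_zsmul,
    neg_le_iff_add_nonneg']

theorem nonneg_add_zsmul_iff_le (hc : 0 < c) (h : c * m = -K) :
    0 ≤ g + m • a ↔ K • a ≤ c • g := by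
  rw [← nsmul_nonneg_iff hc.ne', nsmul_add, ← natCast_zsmul (m • a), smul_smul, h, neg_smul,
    natCast_zsmul, ← sub_eq_add_neg, sub_nonneg]

end OrderedGroup

section Similar

variable {G H : Type*} [AddCommGroup G] [LinearOrder G] [AddCommGroup H] [LinearOrder H]
  {u : G × H} {X Y : Set (G × H)} {p q : G × H} {M N : ℕ}

/-- The components of the elements of `X` satisfy the same linear inequalities with coefficients of
total size at most `N`, and the same congruences with moduli at most `N`. This is the invariant of
the back-and-forth argument, where `u` is the pair of units. -/
structure Similar (u : G × H) (X : Set (G × H)) (N : ℕ) : Prop where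
  nonneg_iff : ∀ p ∈ ball X N, 0 ≤ p.1 ↔ 0 ≤ p.2
  subset_residueSubgroup : ∀ n, 0 < n → n ≤ N → X ⊆ residueSubgroup u n

namespace Similar

theorem anti (h : Similar u X N) (hMN : M ≤ N) : Similar u X M :=
  ⟨fun p hp => h.nonneg_iff p (ball_mono hMN hp),
    fun n h0 hn => h.subset_residueSubgroup n h0 (hn.trans hMN)⟩

theorem subset (h : Similar u X N) (hY : Y ⊆ X) : Similar u Y N :=
  ⟨fun p hp => h.nonneg_iff p (ball_subset_ball hY hp),
    fun n h0 hn => hY.trans (h.subset_residueSubgroup n h0 hn)⟩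

theorem swap (h : Similar u X N) : Similar u.swap (Prod.swap '' X) N := by
  constructor
  · intro p hp
    have := map_mem_ball (AddEquiv.prodComm (M := H) (N := G)).toAddMonoidHom hp
    rw [Set.image_image] at this
    exact (h.nonneg_iff p.swap (by simpa using this)).symm
  · rintro n h0 hn _ ⟨p, hp, rfl⟩
    exact map_mem_residueSubgroup (AddEquiv.prodComm (M := G) (N := H)).toAddMonoidHom
      (h.subset_residueSubgroup n h0 hn hp)

variable [IsOrderedAddMonoid G] [IsOrderedAddMonoid H]

theorem le_iff (h : Similar u X N) {a b : ℕ} (hp : p ∈ ball X a) (hq : q ∈ ball X b)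
    (hab : a + b ≤ N) : p.1 ≤ q.1 ↔ p.2 ≤ q.2 := by
  simpa using h.nonneg_iff _ (ball_mono (by omega) (sub_mem_ball hq hp))

theorem lt_iff (h : Similar u X N) {a b : ℕ} (hp : p ∈ ball X a) (hq : q ∈ ball X b)
    (hab : a + b ≤ N) : p.1 < q.1 ↔ p.2 < q.2 := by
  simpa using (h.le_iff hq hp (by omega)).not

variable {K : ℕ} {a : G} {b : H}

theorem insert_pair (h : Similar u X N) (hK0 : 0 < K) (hK : ∀ n, 0 < n → n ≤ N → n ∣ K)
    (hle : ∀ p ∈ ball X (K * N), p.1 ≤ K • a ↔ p.2 ≤ K • b)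
    (hge : ∀ p ∈ ball X (K * N), K • a ≤ p.1 ↔ K • b ≤ p.2)
    (hres : (a, b) ∈ residueSubgroup u K) : Similar u (insert (a, b) X) N := by
  refine ⟨fun p hp => ?_, fun n h0 hn => Set.insert_subset
    (residueSubgroup_le_of_dvd (hK n h0 hn) hres) (h.subset_residueSubgroup n h0 hn)⟩
  obtain ⟨q, hq, m, hm, rfl⟩ := exists_eq_add_zsmul_of_mem_ball_insert hp
  rcases eq_or_ne m 0 with rfl | hm0
  · simpa using h.nonneg_iff q hq
  obtain ⟨c, hc⟩ := hK m.natAbs (Int.natAbs_pos.2 hm0)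
    (by exact_mod_cast (Int.abs_eq_natAbs m).symm.trans_le hm)
  have hc0 : 0 < c := Nat.pos_of_ne_zero fun h => hK0.ne' (by rw [hc, h, mul_zero])
  have hcK : c ≤ K := hc ▸ Nat.le_mul_of_pos_left c (Int.natAbs_pos.2 hm0)
  have hcq : c • q ∈ ball X (K * N) := ball_mono (Nat.mul_le_mul_right N hcK) (nsmul_mem_ball c hq)
  rcases Int.natAbs_eq m with e | e
  · have hcm : (c : ℤ) * m = K := by rw [e, hc]; push_cast; ring
    exact (nonneg_add_zsmul_iff_neg_le hc0 hcm).trans ((hle _ (neg_mem_ball hcq)).trans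
      (nonneg_add_zsmul_iff_neg_le hc0 hcm).symm)
  · have hcm : (c : ℤ) * m = -K := by rw [e, hc]; push_cast; ring
    exact (nonneg_add_zsmul_iff_le hc0 hcm).trans ((hge _ hcq).trans
      (nonneg_add_zsmul_iff_le hc0 hcm).symm)

end Similar

open scoped Nat

/-- The order of similarity from which a set of pairs can be extended by a further pair to one of
order `N`. The factorial is a common multiple of the coefficients of the new pair. -/
def extendBound (N : ℕ) : ℕ :=
  3 * (N ! * N + N ! * N !) + N

namespace Similar

variable [IsOrderedAddMonoid G] [IsOrderedAddMonoid H] {a : G}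

theorem exists_insert_of_nsmul_eq (hu : IsPresburgerUnit u.1) (h : Similar u X (extendBound N))
    (hp : p ∈ ball X (N ! * N + N ! * N !)) (hpa : N ! • a = p.1) :
    ∃ b, Similar u (insert (a, b) X) N := by
  have hK0 : 0 < N ! := N.factorial_pos
  have bound : extendBound N = 3 * (N ! * N + N ! * N !) + N := rfl
  have hres : p ∈ residueSubgroup u (N ! * N !) := ball_subset_addSubgroup
    (h.subset_residueSubgroup _ (Nat.mul_pos hK0 hK0) (by omega)) hp
  obtain ⟨r, d, hd⟩ := mem_residueSubgroup.1 hres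
  obtain ⟨s, rfl⟩ : (N ! : ℤ) ∣ r := hu.dvd_of_zsmul_eq_nsmul hK0 (h := a - N ! • d.1) <| by
    rw [nsmul_sub, hpa, hd, smul_smul]
    exact (add_sub_cancel_right _ _).symm
  have hp_eq : p = N ! • (s • u + N ! • d) := by
    rw [hd, nsmul_add, mul_smul (N ! : ℤ), natCast_zsmul, smul_smul]
  have ha : a = (s • u + N ! • d).1 :=
    nsmul_right_injective hK0.ne' (hpa.trans (congrArg Prod.fst hp_eq))
  have hpb : N ! • (s • u + N ! • d).2 = p.2 := (congrArg Prod.snd hp_eq).symm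
  refine ⟨(s • u + N ! • d).2, (h.anti (by omega)).insert_pair hK0
    (fun n h0 hn => Nat.dvd_factorial h0 hn) ?_ ?_ (mem_residueSubgroup.2 ⟨s, d, by rw [ha]⟩)⟩
  · intro q hq
    rw [hpa, hpb]
    exact h.le_iff hq hp (by omega)
  · intro q hq
    rw [hpa, hpb]
    exact h.le_iff hp hq (by omega)

theorem exists_insert_of_cut (hu₁ : IsPresburgerUnit u.1) (hu₂ : IsPresburgerUnit u.2) (hu : u ∈ X)
    (h : Similar u X (extendBound N)) {p₀ p₁ : G × H} (hp₀ : p₀ ∈ ball X (N ! * N))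
    (hp₁ : p₁ ∈ ball X (N ! * N)) (hlt : p₀.1 + (N ! * N !) • u.1 < p₁.1)
    (hcut : ∀ p ∈ ball X (N ! * N), p.1 < N ! • a ∧ p.1 ≤ p₀.1 ∨ N ! • a < p.1 ∧ p₁.1 ≤ p.1) :
    ∃ b, Similar u (insert (a, b) X) N := by
  have hK0 : 0 < N ! := N.factorial_pos
  have bound : extendBound N = 3 * (N ! * N + N ! * N !) + N := rfl
  obtain ⟨r, d, rfl⟩ := hu₁.exists_eq_zsmul_add_nsmul hK0 a
  obtain ⟨c, hbelow, habove⟩ := hu₂.exists_nsmul_mem_Ioc hK0 r p₀.2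
  have hlt₂ : p₀.2 + (N ! * N !) • u.2 < p₁.2 :=
    (h.lt_iff (add_mem_ball hp₀ (nsmul_mem_ball_of_mem _ hu)) hp₁ (by omega)).1 hlt
  have hcut₂ (p) (hp : p ∈ ball X (N ! * N)) : p.1 < N ! • (r • u.1 + N ! • d) ∧
      p.2 < N ! • (r • u.2 + N ! • c) ∨ N ! • (r • u.1 + N ! • d) < p.1 ∧
      N ! • (r • u.2 + N ! • c) < p.2 := by
    refine (hcut p hp).imp (And.imp_right fun hpp₀ => ?_) (And.imp_right fun hp₁p => ?_)
    · exact ((h.le_iff hp hp₀ (by omega)).1 hpp₀).trans_lt hbelow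
    · exact (habove.trans_lt hlt₂).trans_le ((h.le_iff hp₁ hp (by omega)).1 hp₁p)
  refine ⟨r • u.2 + N ! • c, (h.anti (by omega)).insert_pair hK0
    (fun n h0 hn => Nat.dvd_factorial h0 hn) ?_ ?_ (mem_residueSubgroup.2 ⟨r, (d, c), rfl⟩)⟩
  · intro p hp
    rcases hcut₂ p hp with ⟨h₁, h₂⟩ | ⟨h₁, h₂⟩
    · exact iff_of_true h₁.le h₂.le
    · exact iff_of_false h₁.not_ge h₂.not_ge
  · intro p hp
    rcases hcut₂ p hp with ⟨h₁, h₂⟩ | ⟨h₁, h₂⟩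
    · exact iff_of_false h₁.not_ge h₂.not_ge
    · exact iff_of_true h₁.le h₂.le

theorem exists_insert (hu₁ : IsPresburgerUnit u.1) (hu₂ : IsPresburgerUnit u.2) (hu : u ∈ X)
    (hX : X.Finite) (hN : 0 < N) (h : Similar u X (extendBound N)) {t : G × H} (ht : t ∈ X)
    (ha : 0 ≤ a) (hat : a ≤ t.1) : ∃ b, Similar u (insert (a, b) X) N := by
  by_cases hnear : ∃ p ∈ ball X (N ! * N + N ! * N !), N ! • a = p.1
  · obtain ⟨p, hp, hpa⟩ := hnear
    exact h.exists_insert_of_nsmul_eq hu₁ hp hpa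
  have hfin := finite_ball hX (N ! * N)
  obtain ⟨p₀, ⟨hp₀, hp₀a⟩, hmax⟩ := (hfin.subset
    (Set.sep_subset _ fun p => p.1 ≤ N ! • a)).exists_maximalFor Prod.fst _
    ⟨0, zero_mem_ball X _, nsmul_nonneg ha _⟩
  obtain ⟨p₁, ⟨hp₁, hp₁a⟩, hmin⟩ := (hfin.subset
    (Set.sep_subset _ fun p => N ! • a ≤ p.1)).exists_minimalFor Prod.fst _
    ⟨N ! • t, ball_mono (Nat.le_mul_of_pos_right _ hN) (nsmul_mem_ball_of_mem _ ht),
      nsmul_le_nsmul_right hat _⟩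
  have hfar : p₀.1 + (N ! * N !) • u.1 < N ! • a := by
    by_contra hle
    obtain ⟨j, hj, e⟩ := hu₁.exists_eq_nsmul_of_le (sub_nonneg.2 hp₀a)
      (sub_le_iff_le_add'.2 (not_lt.1 hle))
    exact hnear ⟨p₀ + j • u, add_mem_ball hp₀ (ball_mono hj (nsmul_mem_ball_of_mem j hu)),
      sub_eq_iff_eq_add'.1 e⟩
  refine h.exists_insert_of_cut hu₁ hu₂ hu hp₀ hp₁ (hfar.trans_le hp₁a) fun p hp => ?_
  have hne : p.1 ≠ N ! • a := fun e => hnear ⟨p, ball_mono (Nat.le_add_right _ _) hp, e.symm⟩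
  refine hne.lt_or_gt.imp (fun hlt => ⟨hlt, ?_⟩) (fun hgt => ⟨hgt, ?_⟩)
  · exact (le_total p.1 p₀.1).elim id (hmax ⟨hp, hlt.le⟩)
  · exact (le_total p₁.1 p.1).elim id (hmin ⟨hp, hgt.le⟩)

end Similar

end Similar

/-! ### Truncated ordered abelian groups -/

/-- The operations of a truncated ordered abelian group, without axioms: `⊤` is `τ` and `-` is
`∸`. -/
class TruncOps (M : Type*) extends Zero M, One M, Add M, Sub M, Top M, LinearOrder M

/-- The amount `x + y - τ` by which a truncated sum exceeds `τ`. -/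
def excess {M : Type*} [TruncOps M] (x y : M) : M := y - (⊤ - x)

/-- The axioms of truncated ordered abelian groups. -/
class IsTOAG (M : Type*) [TruncOps M] : Prop where
  protected zero_le (x : M) : 0 ≤ x
  protected le_top (x : M) : x ≤ ⊤
  protected add_comm (x y : M) : x + y = y + x
  protected add_zero (x : M) : x + 0 = x
  protected add_top (x : M) : x + ⊤ = ⊤
  protected add_le_add {x y z w : M} : x ≤ y → z ≤ w → x + z ≤ y + w
  protected add_assoc (x y z : M) : x + y + z = x + (y + z)
  add_left_cancel_of_lt_top {x y z : M} : x + y = x + z → x + y < ⊤ → y = z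
  add_sub_of_le_of_lt_top {x y : M} : x ≤ y → y < ⊤ → x + (y - x) = y
  sub_eq_zero_of_le {x y : M} : y ≤ x → y - x = 0
  exists_lt_top_add_eq_top {x : M} : 0 < x → ∃ z < ⊤, x + z = ⊤
  add_top_sub (x : M) : x + (⊤ - x) = ⊤
  top_sub_le {x z : M} : x + z = ⊤ → ⊤ - x ≤ z
  top_sub_top_sub (x : M) : ⊤ - (⊤ - x) = x
  excess_comm {x y : M} : x < ⊤ → y < ⊤ → x + y = ⊤ → excess x y = excess y x
  excess_add_eq_excess_add {x y z : M} : y + z < ⊤ → x + (y + z) = ⊤ → y + x < ⊤ →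
    excess (y + z) x = excess (x + y) z
  excess_add_eq_add_excess {x y z : M} : y + z < ⊤ → x + (y + z) = ⊤ → x + y = ⊤ →
    z + excess x y < ⊤ → excess (y + z) x = z + excess x y
  add_excess_lt_top {x y z : M} : y + x = ⊤ → y + z < ⊤ → z + excess x y < ⊤
  add_excess_eq_excess_add {x y z : M} : y + z = ⊤ → y + x = ⊤ → z + excess x y < ⊤ →
    x + excess z y = excess y x + z
  add_excess_eq_top {x y z : M} : y + z = ⊤ → y + x = ⊤ → x + excess z y = ⊤ →
    z + excess x y = ⊤
  excess_excess_comm {x y z : M} : y + z = ⊤ → y + x = ⊤ → x + excess z y = ⊤ →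
    excess z (excess x y) = excess x (excess z y)

section Truncated

variable {M : Type*} [TruncOps M] [IsTOAG M] {a b : M}

instance : AddCommMonoid M where
  add_assoc := IsTOAG.add_assoc
  zero_add x := (IsTOAG.add_comm 0 x).trans (IsTOAG.add_zero x)
  add_zero := IsTOAG.add_zero
  add_comm := IsTOAG.add_comm
  nsmul := nsmulRec

instance : OrderTop M where
  le_top := IsTOAG.le_top

instance : IsOrderedAddMonoid M where
  add_le_add_left _ _ h _ := IsTOAG.add_le_add h le_rfl

instance : CanonicallyOrderedAdd M where
  exists_add_of_le {a b} h := by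
    rcases eq_top_or_lt_top b with rfl | hb
    · exact ⟨⊤, (IsTOAG.add_top a).symm⟩
    · exact ⟨b - a, (IsTOAG.add_sub_of_le_of_lt_top h hb).symm⟩
  le_add_self a b := by simpa only [zero_add] using add_le_add_left (IsTOAG.zero_le b) a
  le_self_add a b := by simpa only [add_zero] using add_le_add_right (IsTOAG.zero_le b) a

instance : OrderedSub M where
  tsub_le_iff_right a b c := by
    rcases le_or_gt a b with hab | hba
    · rw [IsTOAG.sub_eq_zero_of_le hab]
      exact iff_of_true (IsTOAG.zero_le c) (hab.trans le_add_self)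
    rcases eq_top_or_lt_top a with rfl | ha
    · rw [top_le_iff, add_comm c b]
      exact ⟨fun h => top_le_iff.1 ((IsTOAG.add_top_sub b).ge.trans (add_le_add_right h b)),
        IsTOAG.top_sub_le⟩
    · have e := IsTOAG.add_sub_of_le_of_lt_top hba.le ha
      refine ⟨fun h => ?_, fun h => le_of_not_gt fun hc => ?_⟩
      · rw [add_comm c b]
        exact e.ge.trans (add_le_add_right h b)
      · have e' : b + c = b + (a - b) :=
          (add_le_add_right hc.le b).antisymm (by rwa [e, add_comm b c])
        exact hc.ne (IsTOAG.add_left_cancel_of_lt_top e' (e'.trans e ▸ ha))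

theorem exists_add_eq_of_le_of_lt_top (hab : a ≤ b) (hb : b < ⊤) :
    ∃ z, a + z = b ∧ ∀ w, a + w = b → w = z := by
  have e : a + (b - a) = b := add_tsub_cancel_of_le hab
  exact ⟨b - a, e, fun w hw =>
    IsTOAG.add_left_cancel_of_lt_top (hw.trans e.symm) (hw.trans_lt hb)⟩

theorem lt_top_of_add_lt_top_left (h : a + b < ⊤) : a < ⊤ := le_self_add.trans_lt h

theorem lt_top_of_add_lt_top_right (h : a + b < ⊤) : b < ⊤ := le_add_self.trans_lt h

theorem excess_le : excess a b ≤ b := tsub_le_self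

theorem top_sub_lt_top (ha : 0 < a) : ⊤ - a < ⊤ := by
  obtain ⟨z, hz, e⟩ := IsTOAG.exists_lt_top_add_eq_top ha
  exact (IsTOAG.top_sub_le e).trans_lt hz

theorem zero_lt_top [Nontrivial M] : (0 : M) < ⊤ := by
  obtain ⟨a, ha⟩ := exists_ne (0 : M)
  exact (pos_iff_ne_zero.2 ha).trans_le le_top

end Truncated

/-! ### The ordered group generated by a truncated ordered group -/

/-- The element `coeff * τ + rest` of the ordered group in which `M` is the interval from `0`
to `τ`. -/
@[ext]
structure GroupExt (M : Type*) [TruncOps M] where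
  coeff : ℤ
  rest : M
  rest_lt : rest < ⊤

namespace GroupExt

section Add

variable {M : Type*} [TruncOps M] [IsTOAG M] {p q r : GroupExt M}

instance : Add (GroupExt M) where
  add p q :=
    { coeff := p.coeff + q.coeff + if p.rest + q.rest < ⊤ then 0 else 1
      rest := if p.rest + q.rest < ⊤ then p.rest + q.rest else excess p.rest q.rest
      rest_lt := by
        split_ifs with h
        · exact h
        · exact excess_le.trans_lt q.rest_lt }

theorem coeff_add (p q : GroupExt M) :
    (p + q).coeff = p.coeff + q.coeff + if p.rest + q.rest < ⊤ then 0 else 1 := rfl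

theorem rest_add (p q : GroupExt M) :
    (p + q).rest = if p.rest + q.rest < ⊤ then p.rest + q.rest else excess p.rest q.rest := rfl

theorem add_of_lt_top (h : p.rest + q.rest < ⊤) :
    p + q = ⟨p.coeff + q.coeff, p.rest + q.rest, h⟩ := by
  ext
  · rw [coeff_add, if_pos h, add_zero]
  · rw [rest_add, if_pos h]

theorem add_of_eq_top (h : p.rest + q.rest = ⊤) :
    p + q = ⟨p.coeff + q.coeff + 1, excess p.rest q.rest, excess_le.trans_lt q.rest_lt⟩ := by
  ext
  · rw [coeff_add, if_neg h.not_lt]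
  · rw [rest_add, if_neg h.not_lt]

protected theorem add_comm (p q : GroupExt M) : p + q = q + p := by
  rcases eq_top_or_lt_top (p.rest + q.rest) with h | h
  · rw [add_of_eq_top h, add_of_eq_top (by rwa [add_comm])]
    ext
    · exact congrArg (· + 1) (add_comm p.coeff q.coeff)
    · exact IsTOAG.excess_comm p.rest_lt q.rest_lt h
  · rw [add_of_lt_top h, add_of_lt_top (by rwa [add_comm])]
    ext
    · exact add_comm p.coeff q.coeff
    · exact add_comm p.rest q.rest

theorem add_assoc_of_lt_top_of_lt_top (hpq : p.rest + q.rest < ⊤) (hqr : q.rest + r.rest < ⊤) :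
    p + q + r = p + (q + r) := by
  rw [add_of_lt_top hpq, add_of_lt_top hqr]
  rcases eq_top_or_lt_top (p.rest + (q.rest + r.rest)) with h | h
  · rw [add_of_eq_top ((add_assoc _ _ _).trans h), add_of_eq_top h]
    ext
    · dsimp only; ring
    · dsimp only
      rw [IsTOAG.excess_comm p.rest_lt hqr h]
      exact (IsTOAG.excess_add_eq_excess_add hqr h (add_comm p.rest q.rest ▸ hpq)).symm
  · rw [add_of_lt_top ((add_assoc _ _ _).trans_lt h), add_of_lt_top h]
    ext
    · dsimp only; ring
    · exact add_assoc _ _ _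

theorem add_assoc_of_lt_top_of_eq_top (hpq : p.rest + q.rest < ⊤) (hqr : q.rest + r.rest = ⊤) :
    p + q + r = p + (q + r) := by
  have hqp : q.rest + p.rest < ⊤ := add_comm p.rest q.rest ▸ hpq
  have hrq : r.rest + q.rest = ⊤ := add_comm q.rest r.rest ▸ hqr
  have hr : r.rest + (q.rest + p.rest) = ⊤ := by rw [← add_assoc, hrq, add_comm, IsTOAG.add_top]
  have hpqr : p.rest + q.rest + r.rest = ⊤ := by rw [add_assoc, hqr, IsTOAG.add_top]
  have hlt : p.rest + excess r.rest q.rest < ⊤ := IsTOAG.add_excess_lt_top hqr hqp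
  rw [add_of_lt_top hpq, add_of_eq_top hqr, add_of_eq_top (p := ⟨_, _, _⟩) hpqr]
  simp only [IsTOAG.excess_comm q.rest_lt r.rest_lt hqr]
  rw [add_of_lt_top hlt]
  ext
  · dsimp only; ring
  · dsimp only
    rw [add_comm p.rest]
    exact IsTOAG.excess_add_eq_add_excess hqp hr hrq hlt

theorem add_assoc_of_eq_top_of_eq_top (hpq : p.rest + q.rest = ⊤) (hqr : q.rest + r.rest = ⊤) :
    p + q + r = p + (q + r) := by
  have hqp : q.rest + p.rest = ⊤ := add_comm p.rest q.rest ▸ hpq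
  rw [add_of_eq_top hpq, add_of_eq_top hqr]
  simp only [IsTOAG.excess_comm q.rest_lt r.rest_lt hqr]
  have excess_lt : excess p.rest q.rest < ⊤ := excess_le.trans_lt q.rest_lt
  rcases eq_top_or_lt_top (r.rest + excess p.rest q.rest) with h | h
  · have h' : p.rest + excess r.rest q.rest = ⊤ := IsTOAG.add_excess_eq_top hqp hqr h
    rw [add_of_eq_top (by rwa [add_comm]), add_of_eq_top h']
    ext
    · dsimp only; ring
    · dsimp only
      rw [← IsTOAG.excess_excess_comm hqr hqp h']
      exact IsTOAG.excess_comm excess_lt r.rest_lt (by rwa [add_comm])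
  · have h' : p.rest + excess r.rest q.rest < ⊤ := lt_top_iff_ne_top.2 fun h' =>
      h.ne (IsTOAG.add_excess_eq_top hqr hqp h')
    rw [add_of_lt_top (by rwa [add_comm]), add_of_lt_top h']
    ext
    · dsimp only; ring
    · dsimp only
      rw [IsTOAG.add_excess_eq_excess_add hqr hqp h, IsTOAG.excess_comm p.rest_lt q.rest_lt hpq]

protected theorem add_assoc (p q r : GroupExt M) : p + q + r = p + (q + r) := by
  rcases eq_top_or_lt_top (p.rest + q.rest) with hpq | hpq <;>
    rcases eq_top_or_lt_top (q.rest + r.rest) with hqr | hqr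
  · exact add_assoc_of_eq_top_of_eq_top hpq hqr
  · rw [GroupExt.add_comm, GroupExt.add_comm p q, GroupExt.add_comm p, GroupExt.add_comm q r]
    exact (add_assoc_of_lt_top_of_eq_top (by rwa [add_comm]) (by rwa [add_comm])).symm
  · exact add_assoc_of_lt_top_of_eq_top hpq hqr
  · exact add_assoc_of_lt_top_of_lt_top hpq hqr

end Add

variable {M : Type*} [TruncOps M] [IsTOAG M] [Nontrivial M] {p : GroupExt M} {a b : M} {n : ℕ}

instance : Zero (GroupExt M) := ⟨⟨0, 0, zero_lt_top⟩⟩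

instance : Neg (GroupExt M) where
  neg p :=
    { coeff := if p.rest = 0 then -p.coeff else -p.coeff - 1
      rest := if p.rest = 0 then 0 else ⊤ - p.rest
      rest_lt := by
        split_ifs with h
        · exact zero_lt_top
        · exact top_sub_lt_top (pos_iff_ne_zero.2 h) }

theorem coeff_zero : (0 : GroupExt M).coeff = 0 := rfl

theorem rest_zero : (0 : GroupExt M).rest = 0 := rfl

theorem coeff_neg (p : GroupExt M) :
    (-p).coeff = if p.rest = 0 then -p.coeff else -p.coeff - 1 := rfl

theorem rest_neg (p : GroupExt M) : (-p).rest = if p.rest = 0 then 0 else ⊤ - p.rest := rfl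

protected theorem zero_add (p : GroupExt M) : 0 + p = p := by
  have e : (0 : GroupExt M).rest + p.rest = p.rest := zero_add _
  rw [add_of_lt_top (e.trans_lt p.rest_lt)]
  ext
  · exact zero_add p.coeff
  · exact e

protected theorem neg_add_cancel (p : GroupExt M) : -p + p = 0 := by
  rcases eq_or_ne p.rest 0 with h | h
  · have e : (-p).rest + p.rest = 0 := by rw [rest_neg, if_pos h, h, add_zero]
    rw [add_of_lt_top (e.trans_lt zero_lt_top)]
    ext
    · dsimp only; rw [coeff_neg, if_pos h, coeff_zero, neg_add_cancel]
    · exact e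
  · have hrest : (-p).rest = ⊤ - p.rest := by rw [rest_neg, if_neg h]
    rw [add_of_eq_top (by rw [hrest, add_comm, IsTOAG.add_top_sub])]
    ext
    · dsimp only; rw [coeff_neg, if_neg h, coeff_zero]; ring
    · dsimp only; rw [excess, hrest, IsTOAG.top_sub_top_sub, tsub_self, rest_zero]

instance : AddCommGroup (GroupExt M) where
  add_assoc := GroupExt.add_assoc
  zero_add := GroupExt.zero_add
  add_zero p := (GroupExt.add_comm p 0).trans (GroupExt.zero_add p)
  add_comm := GroupExt.add_comm
  neg_add_cancel := GroupExt.neg_add_cancel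
  nsmul := nsmulRec
  zsmul := zsmulRec

/-- The positive cone of the order in which `τ` dominates every remainder. -/
def nonnegCone (M : Type*) [TruncOps M] [IsTOAG M] [Nontrivial M] :
    AddGroupCone (GroupExt M) where
  carrier := {p | 0 ≤ p.coeff}
  zero_mem' := Set.mem_ofPred.2 le_rfl
  add_mem' {p q} hp hq := by
    simp only [Set.mem_ofPred_eq, coeff_add] at *
    split_ifs <;> omega
  eq_zero_of_mem_of_neg_mem' {p} hp hq := by
    simp only [Set.mem_ofPred_eq, coeff_neg] at *
    ext
    · rw [coeff_zero]
      split_ifs at hq <;> omega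
    · rw [rest_zero]
      split_ifs at hq with h
      · exact h
      · omega

theorem mem_nonnegCone : p ∈ nonnegCone M ↔ 0 ≤ p.coeff := Set.mem_ofPred

instance : HasMemOrNegMem (nonnegCone M) where
  mem_or_neg_mem p := by
    simp only [mem_nonnegCone, coeff_neg]
    split_ifs <;> omega

instance : LinearOrder (GroupExt M) :=
  haveI : DecidablePred (· ∈ nonnegCone M) := fun _ => decidable_of_iff _ mem_nonnegCone.symm
  LinearOrder.mkOfAddGroupCone (nonnegCone M)

instance : IsOrderedAddMonoid (GroupExt M) := IsOrderedAddMonoid.mkOfCone (nonnegCone M)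

theorem nonneg_iff : 0 ≤ p ↔ 0 ≤ p.coeff := by
  change p - 0 ∈ nonnegCone M ↔ _
  rw [sub_zero, mem_nonnegCone]

/-- The embedding of `M` onto the interval from `0` to `τ`. -/
def of (a : M) : GroupExt M :=
  if h : a < ⊤ then ⟨0, a, h⟩ else ⟨1, 0, zero_lt_top⟩

theorem of_of_lt_top (h : a < ⊤) : of a = ⟨0, a, h⟩ := dif_pos h

theorem of_top : of (⊤ : M) = ⟨1, 0, zero_lt_top⟩ := dif_neg (lt_irrefl _)

theorem of_zero : of (0 : M) = 0 := of_of_lt_top zero_lt_top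

theorem of_nonneg (a : M) : 0 ≤ of a := by
  rw [nonneg_iff]
  rcases eq_top_or_lt_top a with rfl | h
  · exact of_top (M := M) ▸ Int.one_nonneg
  · exact of_of_lt_top h ▸ le_rfl

theorem of_injective : Function.Injective (of : M → GroupExt M) := by
  have ne_of_top {a : M} (ha : a < ⊤) : of a ≠ of ⊤ := fun h => by
    rw [of_of_lt_top ha, of_top] at h
    exact zero_ne_one (congrArg coeff h)
  intro a b h
  rcases eq_top_or_lt_top a with rfl | ha <;> rcases eq_top_or_lt_top b with rfl | hb
  · rfl
  · exact (ne_of_top hb h.symm).elim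
  · exact (ne_of_top ha h).elim
  · rw [of_of_lt_top ha, of_of_lt_top hb] at h
    exact congrArg rest h

theorem of_add_of_lt_top (h : a + b < ⊤) : of (a + b) = of a + of b := by
  rw [of_of_lt_top h, of_of_lt_top (lt_top_of_add_lt_top_left h),
    of_of_lt_top (lt_top_of_add_lt_top_right h), add_of_lt_top h]
  rfl

theorem of_excess_add_of_top (ha : a < ⊤) (hb : b < ⊤) (h : a + b = ⊤) :
    of (excess a b) + of ⊤ = of a + of b := by
  have e : excess a b + 0 = excess a b := add_zero _
  have hlt : excess a b < ⊤ := excess_le.trans_lt hb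
  rw [of_of_lt_top ha, of_of_lt_top hb, of_of_lt_top hlt, of_top, add_of_lt_top (e.trans_lt hlt),
    add_of_eq_top h]
  ext
  · rfl
  · exact e

theorem of_top_sub (a : M) : of (⊤ - a) = of ⊤ - of a := by
  rw [eq_sub_iff_add_eq]
  rcases eq_zero_or_pos a with rfl | h0
  · rw [tsub_zero, of_zero, add_zero]
  rcases eq_top_or_lt_top a with rfl | h
  · rw [tsub_self, of_zero, zero_add]
  · have excess_eq : excess (⊤ - a) a = 0 := by rw [excess, IsTOAG.top_sub_top_sub, tsub_self]
    rw [← of_excess_add_of_top (top_sub_lt_top h0) h (by rw [add_comm, IsTOAG.add_top_sub]),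
      excess_eq, of_zero, zero_add]

theorem of_le_top (a : M) : of a ≤ of ⊤ := by
  rw [← sub_nonneg, ← of_top_sub]
  exact of_nonneg _

theorem of_sub_of_le (h : b ≤ a) : of (a - b) = of a - of b := by
  rcases eq_top_or_lt_top a with rfl | ha
  · exact of_top_sub b
  · have e := add_tsub_cancel_of_le h
    rw [eq_sub_iff_add_eq', ← of_add_of_lt_top (by rwa [e]), e]

theorem of_strictMono : StrictMono (of : M → GroupExt M) := by
  refine Monotone.strictMono_of_injective (fun a b h => ?_) of_injective
  rw [← sub_nonneg, ← of_sub_of_le h]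
  exact of_nonneg _

theorem of_le_of : of a ≤ of b ↔ a ≤ b := of_strictMono.le_iff_le

theorem of_pos : 0 < of a ↔ 0 < a := by rw [← of_zero, of_strictMono.lt_iff_lt]

theorem of_add_eq_min (a b : M) : of (a + b) = min (of a + of b) (of ⊤) := by
  rcases eq_top_or_lt_top (a + b) with h | h
  · rw [h, eq_comm, min_eq_right_iff]
    rcases eq_top_or_lt_top a with rfl | ha
    · exact le_add_of_nonneg_right (of_nonneg _)
    rcases eq_top_or_lt_top b with rfl | hb
    · exact le_add_of_nonneg_left (of_nonneg _)
    · rw [← of_excess_add_of_top ha hb h]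
      exact le_add_of_nonneg_left (of_nonneg _)
  · rw [← of_add_of_lt_top h, min_eq_left (of_le_top _)]

theorem of_sub_eq_max (a b : M) : of (a - b) = max (of a - of b) 0 := by
  rcases le_total a b with h | h
  · rw [tsub_eq_zero_of_le h, of_zero, max_eq_right (sub_nonpos.2 (of_le_of.2 h))]
  · rw [of_sub_of_le h, max_eq_left (sub_nonneg.2 (of_le_of.2 h))]

theorem of_nsmul_of_lt_top (h : n • a < ⊤) : of (n • a) = n • of a := by
  induction n with
  | zero => simp only [zero_smul, of_zero]
  | succ n ih =>
    rw [succ_nsmul] at h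
    rw [succ_nsmul, succ_nsmul, of_add_of_lt_top h, ih (lt_top_of_add_lt_top_left h)]

theorem of_nsmul_eq_min (n : ℕ) (a : M) : of (n • a) = min (n • of a) (of ⊤) := by
  induction n with
  | zero => rw [zero_smul, zero_smul, of_zero, min_eq_left (of_nonneg _)]
  | succ n ih =>
    rw [succ_nsmul, succ_nsmul, of_add_eq_min, ih, min_add, min_assoc,
      min_eq_right (le_add_of_nonneg_right (of_nonneg _))]

theorem zsmul_of_top (k : ℤ) : k • of (⊤ : M) = ⟨k, 0, zero_lt_top⟩ := by
  have add_zero_lt : (0 : M) + 0 < ⊤ := (add_zero (0 : M)).trans_lt zero_lt_top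
  have nsmul_of_top (k : ℕ) : k • of (⊤ : M) = ⟨k, 0, zero_lt_top⟩ := by
    induction k with
    | zero => exact zero_smul ℕ _
    | succ k ih =>
      rw [succ_nsmul, ih, of_top, add_of_lt_top add_zero_lt]
      ext
      · exact (Nat.cast_succ k).symm
      · exact add_zero 0
  obtain ⟨k, rfl | rfl⟩ := k.eq_nat_or_neg
  · rw [natCast_zsmul, nsmul_of_top]
  · rw [neg_smul, natCast_zsmul, nsmul_of_top]
    ext
    · rw [coeff_neg, if_pos rfl]
    · rw [rest_neg, if_pos rfl]

theorem eq_zsmul_of_top_add_of (p : GroupExt M) : p = p.coeff • of ⊤ + of p.rest := by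
  have e : 0 + p.rest = p.rest := zero_add _
  rw [zsmul_of_top, of_of_lt_top p.rest_lt, add_of_lt_top (e.trans_lt p.rest_lt)]
  ext
  · exact (add_zero p.coeff).symm
  · exact e.symm

theorem exists_of_eq (h0 : 0 ≤ p) (h1 : p ≤ of ⊤) : ∃ a, of a = p := by
  rcases (nonneg_iff.1 h0).eq_or_lt with h | h
  · refine ⟨p.rest, ?_⟩
    conv_rhs => rw [eq_zsmul_of_top_add_of p, ← h, zero_smul, zero_add]
  · refine ⟨⊤, le_antisymm ?_ h1⟩
    calc of ⊤ ≤ p.coeff • of ⊤ := le_smul_of_one_le_left (of_nonneg _) h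
      _ ≤ p.coeff • of ⊤ + of p.rest := le_add_of_nonneg_right (of_nonneg _)
      _ = p := (eq_zsmul_of_top_add_of p).symm

end GroupExt

/-! ### Presburger truncated groups as first-order structures -/

/-- The axioms of Presburger truncated ordered abelian groups; the successor axioms are
consequences of the others. -/
class IsPresTOAG (M : Type*) [TruncOps M] : Prop extends IsTOAG M where
  protected zero_lt_one : (0 : M) < 1
  protected one_le_of_pos {x : M} : 0 < x → 1 ≤ x
  exists_eq_nsmul_add (n : ℕ) (hn : 1 ≤ n) (x : M) : ∃ y : M, ∃ m < n, x = n • y + m • (1 : M)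

section Presburger

variable {M : Type*} [TruncOps M] [IsPresTOAG M] {a b : M}

instance : Nontrivial M := ⟨0, 1, IsPresTOAG.zero_lt_one.ne⟩

theorem lt_add_one_of_lt_top (ha : a < ⊤) : a < a + 1 :=
  le_self_add.lt_of_ne fun h =>
    IsPresTOAG.zero_lt_one.ne
      (IsTOAG.add_left_cancel_of_lt_top ((add_zero a).trans h) ((add_zero a).trans_lt ha))

theorem add_one_le_of_lt (h : a < b) : a + 1 ≤ b :=
  calc a + 1 ≤ a + (b - a) := add_le_add_right (IsPresTOAG.one_le_of_pos (tsub_pos_of_lt h)) a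
    _ = b := add_tsub_cancel_of_le h.le

theorem sub_one_lt (ha : 0 < a) : a - 1 < a := by
  have h : a - 1 < ⊤ :=
    (tsub_le_tsub_right le_top 1).trans_lt (top_sub_lt_top (IsPresTOAG.zero_lt_one (M := M)))
  exact (lt_add_one_of_lt_top h).trans_eq (tsub_add_cancel_of_le (IsPresTOAG.one_le_of_pos ha))

theorem le_of_sub_one_lt (ha : 0 < a) (h : a - 1 < b) : a ≤ b := by
  rw [← tsub_add_cancel_of_le (IsPresTOAG.one_le_of_pos ha)]
  exact add_one_le_of_lt h

theorem GroupExt.of_mem_residueSubgroup_of_lt_top {n : ℕ} (hn : 0 < n) (ha : a < ⊤) :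
    of a ∈ residueSubgroup (of (1 : M)) n := by
  obtain ⟨y, m, -, e⟩ := IsPresTOAG.exists_eq_nsmul_add n hn a
  have h : n • y + m • (1 : M) < ⊤ := e ▸ ha
  rw [mem_residueSubgroup]
  refine ⟨m, of y, ?_⟩
  rw [e, of_add_of_lt_top h, of_nsmul_of_lt_top (lt_top_of_add_lt_top_left h),
    of_nsmul_of_lt_top (lt_top_of_add_lt_top_right h), natCast_zsmul, add_comm]

theorem GroupExt.isPresburgerUnit : IsPresburgerUnit (of (1 : M)) where
  pos := of_pos.2 IsPresTOAG.zero_lt_one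
  le_of_pos p hp := by
    rcases lt_or_ge (of ⊤) p with h | h
    · exact (of_le_top (1 : M)).trans h.le
    · obtain ⟨a, rfl⟩ := exists_of_eq hp.le h
      exact of_le_of.2 (IsPresTOAG.one_le_of_pos (of_pos.1 hp))
  residueSubgroup_eq_top n hn := by
    refine (AddSubgroup.eq_top_iff' _).2 fun p => ?_
    have top_mem : of (⊤ : M) ∈ residueSubgroup (of (1 : M)) n := by
      rw [← sub_add_cancel (of ⊤) (of (1 : M)), ← of_top_sub]
      exact add_mem (of_mem_residueSubgroup_of_lt_top hn (top_sub_lt_top IsPresTOAG.zero_lt_one))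
        self_mem_residueSubgroup
    rw [eq_zsmul_of_top_add_of p]
    exact add_mem (zsmul_mem top_mem _) (of_mem_residueSubgroup_of_lt_top hn p.rest_lt)

end Presburger

section Structure

variable {M : Type*} [TruncOps M] {α : Type*} {s t : toag.Term α} {v : α → M}

instance TruncOps.toStructure : toag.Structure M where
  funMap
    | .zero, _ => 0
    | .one, _ => 1
    | .tau, _ => ⊤
    | .add, w => w 0 + w 1
    | .monus, w => w 0 - w 1
  RelMap
    | .le, w => w 0 ≤ w 1

instance : toag.OrderedStructure M := ⟨fun _ => Iff.rfl⟩

theorem realize_add : (s + t).realize v = s.realize v + t.realize v := rfl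

theorem realize_monus : (s ∸ t).realize v = s.realize v - t.realize v := rfl

theorem realize_mult (n : ℕ) : (mult n t).realize v = nsmulRec n (t.realize v) := by
  induction n with
  | zero => rfl
  | succ n ih => exact congrArg (· + _) ih

theorem model_toagTheory_iff : M ⊨ toagTheory ↔ IsTOAG M := by
  have linear : M ⊨ toag.linearOrderTheory := inferInstance
  simp only [toagTheory, Theory.model_union_iff, Theory.model_insert_iff,
    Theory.model_singleton_iff, linear, true_and]
  simp only [axBounds, axAddComm, axAddZeroTau, axAddMono, axAddAssoc, axCancel, axDiff,
    axMonusDiff, axMonusZero, axCompl, axComplMin, axComplCompl, axCarryComm, axCarryAssoc₁,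
    axCarryAssoc₂, axCarryLt, axCarryAssoc₃, axCarryTau, axCarryAssoc₄, Sentence.Realize,
    Formula.Realize, BoundedFormula.realize_all, BoundedFormula.realize_ex,
    BoundedFormula.realize_inf, BoundedFormula.realize_imp, BoundedFormula.realize_bdEqual,
    Term.realize_le, Term.realize_lt, and_imp]
  constructor
  · rintro ⟨bounds, add_comm, add_zero_top, add_mono, add_assoc, cancel, -, add_sub, sub_zero,
      compl, compl_min, compl_compl, carry_comm, carry_assoc₁, carry_assoc₂, carry_lt, carry_assoc₃,
      carry_top, carry_assoc₄⟩
    exact ⟨fun a => (bounds a).1, fun a => (bounds a).2, add_comm, fun a => (add_zero_top a).1,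
      fun a => (add_zero_top a).2, add_mono _ _ _ _, add_assoc, cancel _ _ _, add_sub _ _,
      sub_zero _ _, compl _, fun a => (compl_min a).1, (compl_min _).2 _, compl_compl,
      carry_comm _ _, carry_assoc₁ _ _ _, carry_assoc₂ _ _ _, carry_lt _ _ _, carry_assoc₃ _ _ _,
      carry_top _ _ _, carry_assoc₄ _ _ _⟩
  · intro _
    exact ⟨fun a => ⟨IsTOAG.zero_le a, le_top⟩, add_comm, fun a => ⟨add_zero a, IsTOAG.add_top a⟩,
      fun _ _ _ _ => add_le_add, add_assoc, fun _ _ _ => IsTOAG.add_left_cancel_of_lt_top,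
      fun _ _ => exists_add_eq_of_le_of_lt_top, fun _ _ => IsTOAG.add_sub_of_le_of_lt_top,
      fun _ _ => IsTOAG.sub_eq_zero_of_le, fun _ => IsTOAG.exists_lt_top_add_eq_top,
      fun a => ⟨IsTOAG.add_top_sub a, fun _ => IsTOAG.top_sub_le⟩, IsTOAG.top_sub_top_sub,
      fun _ _ => IsTOAG.excess_comm, fun _ _ _ => IsTOAG.excess_add_eq_excess_add,
      fun _ _ _ => IsTOAG.excess_add_eq_add_excess, fun _ _ _ => IsTOAG.add_excess_lt_top,
      fun _ _ _ => IsTOAG.add_excess_eq_excess_add, fun _ _ _ => IsTOAG.add_excess_eq_top,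
      fun _ _ _ => IsTOAG.excess_excess_comm⟩

theorem model_presTOAG_iff : M ⊨ presTOAG ↔ IsPresTOAG M := by
  have remainder_iff : M ⊨ ({φ | ∃ n : ℕ, 1 ≤ n ∧ φ = axRemainder n} : toag.Theory) ↔
      ∀ n : ℕ, 1 ≤ n → M ⊨ axRemainder n :=
    ⟨fun h n hn => h.realize_of_mem _ ⟨n, hn, rfl⟩,
      fun h => ⟨by rintro _ ⟨n, hn, rfl⟩; exact h n hn⟩⟩
  simp only [presTOAG, Theory.model_union_iff, Theory.model_insert_iff,
    Theory.model_singleton_iff, model_toagTheory_iff, remainder_iff]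
  simp only [axOne, axHasSucc, axIsSucc, axRemainder, Sentence.Realize,
    Formula.Realize, BoundedFormula.realize_all, BoundedFormula.realize_ex,
    BoundedFormula.realize_inf, BoundedFormula.realize_imp, BoundedFormula.realize_bdEqual,
    BoundedFormula.realize_iSup, Term.realize_le, Term.realize_lt, realize_add, realize_mult]
  constructor
  · rintro ⟨⟨_, one, -⟩, remainder⟩
    refine ⟨one.1, one.2 _, fun n hn a => ?_⟩
    obtain ⟨b, m, e⟩ := remainder n hn a
    exact ⟨b, m, m.2, e⟩
  · intro _
    refine ⟨⟨inferInstance, ⟨IsPresTOAG.zero_lt_one, fun _ => IsPresTOAG.one_le_of_pos⟩,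
      fun a ha => ⟨a + 1, lt_add_one_of_lt_top ha, fun _ => add_one_le_of_lt⟩,
      fun a ha => ⟨a - 1, sub_one_lt ha, fun _ => le_of_sub_one_lt ha⟩⟩, fun n hn a => ?_⟩
    obtain ⟨b, m, hm, e⟩ := IsPresTOAG.exists_eq_nsmul_add n hn a
    exact ⟨b, ⟨m, hm⟩, e⟩

end Structure

theorem exists_truncOps_of_model {M : Type*} [inst : toag.Structure M] (h : M ⊨ presTOAG) :
    ∃ _ : TruncOps M, inst = TruncOps.toStructure ∧ IsPresTOAG M := by
  classical
  have : M ⊨ toag.linearOrderTheory := h.mono fun φ hφ => Or.inl (Or.inl (Or.inl hφ))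
  let ops : TruncOps M :=
    { toag.linearOrderOfModels M with
      zero := Structure.funMap (L := toag) ToagFunc.zero ![]
      one := Structure.funMap (L := toag) ToagFunc.one ![]
      top := Structure.funMap (L := toag) ToagFunc.tau ![]
      add := fun a b => Structure.funMap (L := toag) ToagFunc.add ![a, b]
      sub := fun a b => Structure.funMap (L := toag) ToagFunc.monus ![a, b] }
  have eq_cons (w : Fin 2 → M) : w = ![w 0, w 1] := List.ofFn_inj.1 rfl
  have e : inst = TruncOps.toStructure := by
    ext n f w
    · cases f with
      | zero | one | tau => exact congrArg _ (Subsingleton.elim _ _)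
      | add | monus => exact congrArg _ (eq_cons w)
    · cases f with
      | le => exact iff_of_eq (congrArg _ (eq_cons w))
  refine ⟨ops, e, model_presTOAG_iff.1 ?_⟩
  rwa [← e]

section Congruence

open GroupExt

variable {M : Type*} [TruncOps M] [IsPresTOAG M] {d z : M} {n : ℕ}

/-- Congruence modulo `n` in the group generated by `M`. -/
def CongMod (n : ℕ) (a b : M) : Prop := ∃ h : GroupExt M, of a - of b = n • h

theorem nsmul_eq_sub_iff (hz : z ≤ d) : n • z = d - z ↔ of d = (n + 1) • of z := by
  constructor
  · intro e
    have not_truncated : n • z < ⊤ := by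
      refine lt_top_iff_ne_top.2 fun h => ?_
      obtain rfl : d = ⊤ := top_le_iff.1 (h ▸ e ▸ tsub_le_self)
      have z_eq : z = 0 := by rw [← IsTOAG.top_sub_top_sub z, ← e, h, tsub_self]
      exact zero_lt_top.ne (by rw [← h, z_eq, smul_zero])
    rw [succ_nsmul, ← of_nsmul_of_lt_top not_truncated, e, of_sub_of_le hz, sub_add_cancel]
  · intro e
    have nsmul_le : n • of z ≤ of d := by
      rw [e, succ_nsmul]
      exact le_add_of_nonneg_right (of_nonneg z)
    apply of_injective
    rw [of_sub_of_le hz, e, succ_nsmul, add_sub_cancel_right, of_nsmul_eq_min,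
      min_eq_left (nsmul_le.trans (of_le_top d))]

theorem exists_nsmul_eq_sub_iff (hn : 1 ≤ n) :
    (∃ z ≤ d, (n - 1) • z = d - z) ↔ ∃ h : GroupExt M, of d = n • h := by
  obtain ⟨n, rfl⟩ := Nat.exists_eq_add_of_le' hn
  rw [Nat.add_sub_cancel]
  constructor
  · rintro ⟨z, hz, e⟩
    exact ⟨of z, (nsmul_eq_sub_iff hz).1 e⟩
  · rintro ⟨h, e⟩
    have h0 : 0 ≤ h := (nsmul_nonneg_iff n.succ_ne_zero).1 (e ▸ of_nonneg d)
    have h_le : h ≤ of d := e ▸ le_self_nsmul h0 (by omega)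
    obtain ⟨z, rfl⟩ := exists_of_eq h0 (h_le.trans (of_le_top d))
    exact ⟨z, of_le_of.1 h_le, (nsmul_eq_sub_iff (of_le_of.1 h_le)).2 e⟩

theorem realize_congruent (hn : 1 ≤ n) (w : Empty → M) (v : Fin 2 → M) :
    (congruent n).Realize w v ↔ CongMod n (v 0) (v 1) := by
  have realize_iff : (congruent n).Realize w v ↔
      ∃ z ≤ (v 0 - v 1) + (v 1 - v 0), (n - 1) • z = (v 0 - v 1) + (v 1 - v 0) - z := by
    simp only [congruent, isMultiple, BoundedFormula.realize_ex, BoundedFormula.realize_inf,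
      BoundedFormula.realize_bdEqual, Term.realize_le, realize_mult]
    rfl
  rw [realize_iff, exists_nsmul_eq_sub_iff hn, CongMod]
  rcases le_total (v 0) (v 1) with h | h
  · rw [tsub_eq_zero_of_le h, zero_add, of_sub_of_le h, ← (Equiv.neg _).exists_congr_right]
    simp only [Equiv.neg_apply, smul_neg, ← neg_eq_iff_eq_neg, neg_sub]
  · rw [tsub_eq_zero_of_le h, add_zero, of_sub_of_le h]

theorem nsmul_one_lt_top_iff : n • (1 : M) < ⊤ ↔ (n + 1) • of (1 : M) ≤ of ⊤ := by
  rw [succ_nsmul]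
  constructor
  · intro h
    rw [← of_nsmul_of_lt_top h, add_comm, ← le_sub_iff_add_le, ← of_top_sub, of_le_of]
    exact IsPresTOAG.one_le_of_pos (tsub_pos_of_lt h)
  · intro h
    have h_lt : n • of (1 : M) < of ⊤ :=
      (lt_add_of_pos_right _ (of_pos.2 IsPresTOAG.zero_lt_one)).trans_le h
    rwa [← of_strictMono.lt_iff_lt, of_nsmul_eq_min, min_eq_left h_lt.le]

theorem pred_nsmul_one_lt_top_iff : (n - 1) • (1 : M) < ⊤ ↔ n • of (1 : M) ≤ of ⊤ := by
  rcases n with _ | n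
  · rw [zero_tsub, zero_smul, zero_smul]
    exact iff_of_true zero_lt_top (of_nonneg ⊤)
  · exact nsmul_one_lt_top_iff

theorem realize_tauResidue {q : ℕ} (hq : 1 ≤ q) (m : ℕ) :
    M ⊨ tauResidue q m ↔
      m • of (1 : M) ≤ of ⊤ ∧ ∃ h : GroupExt M, of (⊤ : M) - m • of 1 = q • h := by
  have realize_iff : M ⊨ tauResidue q m ↔ (m - 1) • (1 : M) < ⊤ ∧
      ∃ z ≤ ⊤ - m • (1 : M), (q - 1) • z = ⊤ - m • (1 : M) - z := by
    simp only [tauResidue, isMultiple, Sentence.Realize, Formula.Realize,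
      BoundedFormula.realize_ex, BoundedFormula.realize_inf, BoundedFormula.realize_bdEqual,
      Term.realize_le, Term.realize_lt, realize_monus, realize_mult]
    rfl
  rw [realize_iff, pred_nsmul_one_lt_top_iff]
  refine and_congr_right fun h => ?_
  rw [exists_nsmul_eq_sub_iff hq, of_top_sub, of_nsmul_eq_min, min_eq_left h]

theorem realize_tauEq : M ⊨ tauEq n ↔ of (⊤ : M) = n • of 1 := by
  have realize_iff : M ⊨ tauEq n ↔ (n - 1) • (1 : M) < ⊤ ∧ n • (1 : M) = ⊤ := by
    simp only [tauEq, Sentence.Realize, Formula.Realize, BoundedFormula.realize_inf,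
      BoundedFormula.realize_bdEqual, Term.realize_lt, realize_mult]
    rfl
  rw [realize_iff, pred_nsmul_one_lt_top_iff, ← of_injective.eq_iff, of_nsmul_eq_min,
    min_eq_right_iff, le_antisymm_iff, and_comm]

instance TruncOps.toCongStructure : toagCong.Structure M where
  funMap
    | .inl f, w => Structure.funMap (L := toag) f w
  RelMap
    | .inl R, w => Structure.RelMap (L := toag) R w
    | .inr (.cong n _), w => CongMod n (w 0) (w 1)

instance : toagIncl.IsExpansionOn M := ⟨fun _ _ => rfl, fun _ _ => rfl⟩

end Congruence

theorem exists_truncOps_of_model_presTOAGCong {M : Type*} [inst : toagCong.Structure M]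
    (h : M ⊨ presTOAGCong) :
    ∃ (_ : TruncOps M) (_ : IsPresTOAG M), inst = TruncOps.toCongStructure := by
  let _ : toag.Structure M := toagIncl.reduct M
  have := toagIncl.isExpansionOn_reduct M
  obtain ⟨model_presTOAG, model_axCong⟩ := Theory.model_union_iff.1 h
  obtain ⟨ops, e, hM⟩ := exists_truncOps_of_model ((LHom.onTheory_model _ _).1 model_presTOAG)
  have relMap_cong (n : ℕ) (hn : 2 ≤ n) (a b : M) :
      Structure.RelMap (congSymb n hn) ![a, b] ↔ CongMod n a b := by
    have h := model_axCong.realize_of_mem _ ⟨n, hn, rfl⟩ a b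
    rw [BoundedFormula.realize_iff, LHom.realize_onBoundedFormula] at h
    have realize_congruent_iff (v : Empty → M) (w : Fin 2 → M) :
        (congruent n).Realize v w ↔ CongMod n (w 0) (w 1) := by
      rw [e]
      exact realize_congruent (by omega) v w
    exact BoundedFormula.realize_rel₂.symm.trans (h.trans (realize_congruent_iff _ _))
  refine ⟨ops, hM, ?_⟩
  ext k f w
  · cases f with
    | inl f => exact congrArg (fun S : toag.Structure M => S.funMap f w) e
    | inr f => exact f.elim
  · cases f with
    | inl R => exact iff_of_eq (congrArg (fun S : toag.Structure M => S.RelMap R w) e)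
    | inr R =>
      obtain ⟨n, hn⟩ := R
      have eq_cons : w = ![w 0, w 1] := List.ofFn_inj.1 rfl
      rw [eq_cons]
      exact relMap_cong n hn _ _

/-! ### Formulas of bounded depth only see similarity of tuples -/

section Residue

variable {G H : Type*} [AddCommGroup G] [LinearOrder G] [IsOrderedAddMonoid G]
  [AddCommGroup H] [LinearOrder H] [IsOrderedAddMonoid H] {n : ℕ}

theorem IsPresburgerUnit.exists_eq_nsmul_iff_dvd {u g h : G} (hu : IsPresburgerUnit u) {r : ℤ}
    (hn : 0 < n) (e : g = r • u + n • h) : (∃ k, g = n • k) ↔ (n : ℤ) ∣ r := by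
  constructor
  · rintro ⟨k, rfl⟩
    exact hu.dvd_of_zsmul_eq_nsmul hn (h := k - h) (by rw [nsmul_sub, e]; abel)
  · rintro ⟨s, rfl⟩
    exact ⟨s • u + h, by rw [e, mul_smul, natCast_zsmul, smul_add]⟩

theorem exists_fst_eq_nsmul_iff_snd {u p : G × H} (hu₁ : IsPresburgerUnit u.1)
    (hu₂ : IsPresburgerUnit u.2) (hn : 0 < n) (hp : p ∈ residueSubgroup u n) :
    (∃ g, p.1 = n • g) ↔ ∃ h, p.2 = n • h := by
  obtain ⟨r, k, rfl⟩ := mem_residueSubgroup.1 hp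
  exact (hu₁.exists_eq_nsmul_iff_dvd hn rfl).trans (hu₂.exists_eq_nsmul_iff_dvd hn rfl).symm

end Residue

section Depth

variable {α : Type*}

/-- Every term is given piecewise by linear forms in its variables, `1` and `τ`; the cost of the
term bounds the length of these linear forms. -/
def cost : toagCong.Term α → ℕ
  | .var _ => 1
  | .func _ ts => 2 + ∑ i, cost (ts i)

/-- The modulus of the residues on which a relation depends: `n` for `≡_n`, and `1` for `≤`. -/
def relModulus {l : ℕ} : toagCong.Relations l → ℕ
  | .inl _ => 1
  | .inr (.cong n _) => n

/-- The order of similarity which guarantees that two tuples agree on a formula. -/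
def depth : ∀ {n : ℕ}, toagCong.BoundedFormula α n → ℕ
  | _, .falsum => 1
  | _, .equal s t => cost s + cost t
  | _, .rel R ts => relModulus R + ∑ i, cost (ts i)
  | _, .imp φ ψ => max (depth φ) (depth ψ)
  | _, .all φ => extendBound (depth φ + 1)

theorem cost_pos (t : toagCong.Term α) : 0 < cost t := by
  cases t <;> simp only [cost] <;> omega

theorem cost_le_sum_cost {l : ℕ} (ts : Fin l → toagCong.Term α) (i : Fin l) :
    cost (ts i) ≤ ∑ i, cost (ts i) :=
  Finset.single_le_sum (f := fun i => cost (ts i)) (fun _ _ => Nat.zero_le _) (Finset.mem_univ i)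

theorem relModulus_pos {l : ℕ} : ∀ R : toagCong.Relations l, 0 < relModulus R
  | .inl _ => one_pos
  | .inr (.cong _ hn) => zero_lt_two.trans_le hn

theorem depth_pos {n : ℕ} (φ : toagCong.BoundedFormula α n) : 0 < depth φ := by
  induction φ with
  | falsum => exact one_pos
  | equal s t => exact Nat.add_pos_left (cost_pos s) _
  | rel R ts => exact Nat.add_pos_left (relModulus_pos R) _
  | imp φ ψ ih _ => exact ih.trans_le (le_max_left _ _)
  | all φ _ => exact Nat.succ_pos _

end Depth

section BackAndForth

open GroupExt

variable {M : Type u} {N : Type v} [TruncOps M] [IsPresTOAG M] [TruncOps N] [IsPresTOAG N]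
  {α β : Type*} {K n : ℕ}

/-- The pairs of corresponding entries of two tuples, together with the pairs of constants `1`
and `τ`. -/
def pairSet (a : β → M) (b : β → N) : Set (GroupExt M × GroupExt N) :=
  {(of 1, of 1), (of ⊤, of ⊤)} ∪ Set.range fun i => (of (a i), of (b i))

/-- Two tuples are similar of order `K` if the linear forms of length at most `K` in their entries
and the constants have the same signs, and the entries have the same residues modulo all
`n ≤ K`. -/
abbrev SimilarTuples (a : β → M) (b : β → N) (K : ℕ) : Prop :=
  Similar (of 1, of 1) (pairSet a b) K

section

variable {a : β → M} {b : β → N}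

theorem one_mem_pairSet : ((of 1, of 1) : GroupExt M × GroupExt N) ∈ pairSet a b :=
  Or.inl (Or.inl rfl)

theorem top_mem_pairSet : ((of ⊤, of ⊤) : GroupExt M × GroupExt N) ∈ pairSet a b :=
  Or.inl (Or.inr rfl)

theorem mem_pairSet (i : β) : (of (a i), of (b i)) ∈ pairSet a b :=
  Or.inr ⟨i, rfl⟩

theorem finite_pairSet [Finite β] : (pairSet a b).Finite :=
  (Set.toFinite _).union (Set.finite_range _)

theorem SimilarTuples.symm (h : SimilarTuples a b K) : SimilarTuples b a K := by
  have swap_image_pairSet : Prod.swap '' pairSet a b = pairSet b a := by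
    rw [pairSet, Set.image_union, Set.image_pair, ← Set.range_comp]
    rfl
  rw [SimilarTuples, ← swap_image_pairSet]
  exact Similar.swap h

end

section Extension

variable {v : α → M} {w : α → N} {xs : Fin n → M} {ys : Fin n → N}

theorem pairSet_snoc_subset (a : M) (b : N) :
    pairSet (Sum.elim v (Fin.snoc xs a : Fin (n + 1) → M))
        (Sum.elim w (Fin.snoc ys b : Fin (n + 1) → N)) ⊆
      insert (of a, of b) (pairSet (Sum.elim v xs) (Sum.elim w ys)) := by
  rintro _ (hconst | ⟨i | i, rfl⟩)
  · exact Or.inr (Or.inl hconst)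
  · exact Or.inr (mem_pairSet (Sum.inl i))
  · induction i using Fin.lastCases with
    | last =>
      left
      simp only [Sum.elim_inr, Fin.snoc_last]
    | cast i =>
      right
      simpa only [Sum.elim_inr, Fin.snoc_castSucc] using
        mem_pairSet (a := Sum.elim v xs) (b := Sum.elim w ys) (Sum.inr i)

theorem SimilarTuples.exists_snoc [Finite α]
    (h : SimilarTuples (Sum.elim v xs) (Sum.elim w ys) (extendBound (K + 1))) (hK : 0 < K) (a : M) :
    ∃ b : N, SimilarTuples (Sum.elim v (Fin.snoc xs a : Fin (n + 1) → M))
      (Sum.elim w (Fin.snoc ys b : Fin (n + 1) → N)) K := by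
  obtain ⟨g, hg⟩ := Similar.exists_insert isPresburgerUnit isPresburgerUnit one_mem_pairSet
    finite_pairSet (Nat.succ_pos K) h top_mem_pairSet (of_nonneg a) (of_le_top a)
  have pair_mem := mem_ball_one
    (Set.mem_insert (of a, g) (pairSet (Sum.elim v xs) (Sum.elim w ys)))
  have top_mem := mem_ball_one
    (Set.mem_insert_of_mem (of a, g) (top_mem_pairSet (a := Sum.elim v xs) (b := Sum.elim w ys)))
  obtain ⟨b, rfl⟩ := exists_of_eq
    ((hg.le_iff (zero_mem_ball _ 0) pair_mem (by omega)).1 (of_nonneg a))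
    ((hg.le_iff pair_mem top_mem (by omega)).1 (of_le_top a))
  exact ⟨b, (hg.subset (pairSet_snoc_subset a b)).anti (Nat.le_succ K)⟩

end Extension

section Terms

variable {a : β → M} {b : β → N} {i j : ℕ} {c c' : M} {d d' : N}

theorem SimilarTuples.of_add_mem_ball (h : SimilarTuples a b K)
    (hc : (of c, of d) ∈ ball (pairSet a b) i) (hc' : (of c', of d') ∈ ball (pairSet a b) j)
    (hK : i + j + 1 ≤ K) :
    (of (c + c'), of (d + d')) ∈ ball (pairSet a b) (i + j + 1) := by
  have sum_mem := add_mem_ball hc hc'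
  have top_mem := mem_ball_one (top_mem_pairSet (a := a) (b := b))
  have le_top_iff : of c + of c' ≤ of ⊤ ↔ of d + of d' ≤ of ⊤ := h.le_iff sum_mem top_mem hK
  rw [of_add_eq_min, of_add_eq_min]
  rcases le_or_gt (of c + of c') (of ⊤) with hle | hlt
  · rw [min_eq_left hle, min_eq_left (le_top_iff.1 hle)]
    exact ball_mono (by omega) sum_mem
  · rw [min_eq_right hlt.le, min_eq_right (not_le.1 (le_top_iff.not.1 hlt.not_ge)).le]
    exact ball_mono (by omega) top_mem

theorem SimilarTuples.of_sub_mem_ball (h : SimilarTuples a b K)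
    (hc : (of c, of d) ∈ ball (pairSet a b) i) (hc' : (of c', of d') ∈ ball (pairSet a b) j)
    (hK : i + j ≤ K) :
    (of (c - c'), of (d - d')) ∈ ball (pairSet a b) (i + j) := by
  have le_iff : of c ≤ of c' ↔ of d ≤ of d' := h.le_iff hc hc' hK
  rw [of_sub_eq_max, of_sub_eq_max]
  rcases le_or_gt (of c) (of c') with hle | hlt
  · rw [max_eq_right (sub_nonpos.2 hle), max_eq_right (sub_nonpos.2 (le_iff.1 hle))]
    exact zero_mem_ball _ _
  · rw [max_eq_left (sub_nonneg.2 hlt.le),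
      max_eq_left (sub_nonneg.2 (not_le.1 (le_iff.not.1 hlt.not_ge)).le)]
    exact sub_mem_ball hc hc'

theorem SimilarTuples.of_realize_mem_ball (h : SimilarTuples a b K) (t : toagCong.Term β)
    (ht : cost t ≤ K) :
    (of (t.realize a), of (t.realize b)) ∈ ball (pairSet a b) (cost t) := by
  induction t with
  | var i => exact mem_ball_one (mem_pairSet i)
  | func f ts ih =>
    simp only [cost] at ht ⊢
    have args_mem (i) := ih i ((cost_le_sum_cost ts i).trans (by omega))
    rcases f with f | f
    · cases f with
      | zero =>
        change (of 0, of 0) ∈ ball (pairSet a b) _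
        rw [of_zero, of_zero]
        exact zero_mem_ball _ _
      | one => exact ball_mono (by omega) (mem_ball_one one_mem_pairSet)
      | tau => exact ball_mono (by omega) (mem_ball_one top_mem_pairSet)
      | add =>
        rw [Fin.sum_univ_two] at ht ⊢
        exact ball_mono (by omega) (h.of_add_mem_ball (args_mem 0) (args_mem 1) (by omega))
      | monus =>
        rw [Fin.sum_univ_two] at ht ⊢
        exact ball_mono (by omega) (h.of_sub_mem_ball (args_mem 0) (args_mem 1) (by omega))
    · exact f.elim

end Terms

theorem SimilarTuples.relMap_iff {l : ℕ} {a : β → M} {b : β → N} (R : toagCong.Relations l)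
    (ts : Fin l → toagCong.Term β)
    (h : SimilarTuples a b (relModulus R + ∑ i, cost (ts i))) :
    Structure.RelMap R (fun i => (ts i).realize a) ↔
      Structure.RelMap R fun i => (ts i).realize b := by
  have args_mem (i) := h.of_realize_mem_ball (ts i)
    ((cost_le_sum_cost ts i).trans (Nat.le_add_left _ _))
  rcases R with R | R
  · cases R
    rw [Fin.sum_univ_two] at h
    have le_iff := h.le_iff (args_mem 0) (args_mem 1) (Nat.le_add_left _ _)
    rwa [of_le_of, of_le_of] at le_iff
  · obtain ⟨m, hm⟩ := R
    have diff_mem : _ ∈ residueSubgroup ((of 1, of 1) : GroupExt M × GroupExt N) m :=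
      ball_subset_addSubgroup (h.subset_residueSubgroup m (by omega) (Nat.le_add_right _ _))
        (sub_mem_ball (args_mem 0) (args_mem 1))
    exact exists_fst_eq_nsmul_iff_snd isPresburgerUnit isPresburgerUnit (by omega) diff_mem

theorem SimilarTuples.realize_iff [Finite α] (φ : toagCong.BoundedFormula α n) {v : α → M}
    {w : α → N} {xs : Fin n → M} {ys : Fin n → N}
    (h : SimilarTuples (Sum.elim v xs) (Sum.elim w ys) (depth φ)) :
    φ.Realize v xs ↔ φ.Realize w ys := by
  induction φ with
  | falsum => rfl
  | equal s t =>
    have hs := h.of_realize_mem_ball s (Nat.le_add_right _ _)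
    have ht := h.of_realize_mem_ball t (Nat.le_add_left _ _)
    have le_iff := h.le_iff hs ht le_rfl
    have ge_iff := h.le_iff ht hs (add_comm _ _).le
    simp only [of_le_of] at le_iff ge_iff
    simp only [BoundedFormula.Realize, le_antisymm_iff, le_iff, ge_iff]
  | rel R ts => exact SimilarTuples.relMap_iff R ts h
  | imp φ ψ ihφ ihψ =>
    rw [BoundedFormula.realize_imp, BoundedFormula.realize_imp,
      ihφ (Similar.anti h (le_max_left _ _)), ihψ (Similar.anti h (le_max_right _ _))]
  | all φ ih =>
    rw [BoundedFormula.realize_all, BoundedFormula.realize_all]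
    constructor
    · intro hφ b
      obtain ⟨a, hab⟩ := h.symm.exists_snoc (depth_pos φ) b
      exact (ih hab.symm).1 (hφ a)
    · intro hφ a
      obtain ⟨b, hab⟩ := h.exists_snoc (depth_pos φ) a
      exact (ih hab).2 (hφ b)

theorem SimilarTuples.realize_formula_iff [Finite α] (φ : toagCong.Formula α) {v : α → M}
    {w : α → N} (h : SimilarTuples v w (depth φ)) : φ.Realize v ↔ φ.Realize w := by
  refine SimilarTuples.realize_iff φ (Similar.subset h ?_)
  rintro _ (hconst | ⟨i | i, rfl⟩)
  · exact Or.inl hconst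
  · exact mem_pairSet i
  · exact i.elim0

end BackAndForth

/-! ### Model completeness -/

section Embedding

open GroupExt

section Map

variable {M N : Type*} [TruncOps M] [TruncOps N] (f : M ↪[toag] N)

theorem embedding_zero : f 0 = 0 := f.map_fun (ToagFunc.zero : toag.Functions 0) ![]

theorem embedding_one : f 1 = 1 := f.map_fun (ToagFunc.one : toag.Functions 0) ![]

theorem embedding_top : f ⊤ = ⊤ := f.map_fun (ToagFunc.tau : toag.Functions 0) ![]

theorem embedding_add (a b : M) : f (a + b) = f a + f b :=
  f.map_fun (ToagFunc.add : toag.Functions 2) ![a, b]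

theorem embedding_sub (a b : M) : f (a - b) = f a - f b :=
  f.map_fun (ToagFunc.monus : toag.Functions 2) ![a, b]

theorem embedding_le_iff {a b : M} : f a ≤ f b ↔ a ≤ b :=
  f.map_rel (ToagRel.le : toag.Relations 2) ![a, b]

theorem embedding_excess (a b : M) : f (excess a b) = excess (f a) (f b) := by
  rw [excess, excess, embedding_sub, embedding_sub, embedding_top]

theorem embedding_lt_top_iff {a : M} : f a < ⊤ ↔ a < ⊤ := by
  rw [← embedding_top f, ← not_le, ← not_le, embedding_le_iff]

variable [IsTOAG M] [IsTOAG N] [Nontrivial M] [Nontrivial N]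

/-- The extension of an embedding of truncated groups to the enveloping ordered groups. -/
def GroupExt.map : GroupExt M →+ GroupExt N :=
  AddMonoidHom.mk' (fun p => ⟨p.coeff, f p.rest, (embedding_lt_top_iff f).2 p.rest_lt⟩)
    fun p q => by
      rcases eq_top_or_lt_top (p.rest + q.rest) with h | h
      · rw [add_of_eq_top h, add_of_eq_top ((embedding_add f _ _).symm.trans
          ((congrArg f h).trans (embedding_top f)))]
        simp only [embedding_excess]
      · rw [add_of_lt_top h, add_of_lt_top (by
          rw [← embedding_add, embedding_lt_top_iff]
          exact h)]
        simp only [embedding_add]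

theorem GroupExt.map_of (a : M) : GroupExt.map f (of a) = of (f a) := by
  rcases eq_top_or_lt_top a with rfl | ha
  · rw [embedding_top, of_top, of_top]
    exact GroupExt.ext rfl (embedding_zero f)
  · rw [of_of_lt_top ha, of_of_lt_top ((embedding_lt_top_iff f).2 ha)]
    rfl

end Map

theorem similarTuples_comp_embedding {M : Type u} {N : Type v} [TruncOps M] [IsPresTOAG M]
    [TruncOps N] [IsPresTOAG N] (f : M ↪[toag] N) {α : Type*} (a : α → M) (K : ℕ) :
    SimilarTuples a (f ∘ a) K := by
  have one_eq : GroupExt.map f (of 1) = of 1 := (map_of f 1).trans (congrArg of (embedding_one f))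
  have mem_graph : pairSet a (f ∘ a) ⊆ (GroupExt.map f).graph := by
    rintro _ ((rfl | rfl) | ⟨i, rfl⟩)
    · exact one_eq
    · exact (map_of f ⊤).trans (congrArg of (embedding_top f))
    · exact map_of f (a i)
  refine ⟨fun p hp => ?_, fun n hn _ p hp => ?_⟩
  · have map_eq : GroupExt.map f p.1 = p.2 := ball_subset_addSubgroup mem_graph hp
    rw [← map_eq, nonneg_iff, nonneg_iff]
    rfl
  · have hp₁ : p.1 ∈ residueSubgroup (of (1 : M)) n := by
      rw [isPresburgerUnit.residueSubgroup_eq_top n hn]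
      exact AddSubgroup.mem_top _
    have := map_mem_residueSubgroup ((AddMonoidHom.id _).prod (GroupExt.map f)) hp₁
    rwa [AddMonoidHom.prod_apply, AddMonoidHom.prod_apply, one_eq,
      show GroupExt.map f p.1 = p.2 from mem_graph hp] at this

end Embedding

theorem isModelComplete_presTOAG : IsModelComplete.{u, v} presTOAG := by
  intro M N _ _ hM hN f
  obtain ⟨_, rfl, _⟩ := exists_truncOps_of_model hM
  obtain ⟨_, rfl, _⟩ := exists_truncOps_of_model hN
  refine ⟨⟨f, fun n φ a => ?_⟩, fun _ => rfl⟩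
  have := SimilarTuples.realize_formula_iff (toagIncl.onFormula φ)
    (similarTuples_comp_embedding f a _)
  rw [LHom.realize_onFormula, LHom.realize_onFormula] at this
  exact this.symm

/-! ### Quantifier elimination -/

section AtomicCriterion

open GroupExt

variable {β : Type*}

/-- The terms of nesting depth at most `n` in the variables `β`. -/
def termSet (β : Type*) : ℕ → Set (toag.Term β)
  | 0 => {0, 1, tau} ∪ Set.range Term.var
  | n + 1 => termSet β n ∪ (Set.image2 (· + ·) (termSet β n) (termSet β n) ∪
      Set.image2 monus (termSet β n) (termSet β n))

section TermSet

variable {m n : ℕ} {s t : toag.Term β}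

theorem finite_termSet [Finite β] (n : ℕ) : (termSet β n).Finite := by
  induction n with
  | zero => exact (Set.toFinite _).union (Set.finite_range _)
  | succ n ih => exact ih.union ((ih.image2 _ ih).union (ih.image2 _ ih))

theorem termSet_mono (h : m ≤ n) : termSet β m ⊆ termSet β n := by
  induction h with
  | refl => exact le_rfl
  | step _ ih => exact ih.trans Set.subset_union_left

theorem add_mem_termSet (hs : s ∈ termSet β n) (ht : t ∈ termSet β n) :
    s + t ∈ termSet β (n + 1) := Or.inr (Or.inl ⟨s, hs, t, ht, rfl⟩)

theorem monus_mem_termSet (hs : s ∈ termSet β n) (ht : t ∈ termSet β n) :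
    s ∸ t ∈ termSet β (n + 1) := Or.inr (Or.inr ⟨s, hs, t, ht, rfl⟩)

theorem zero_mem_termSet (n : ℕ) : (0 : toag.Term β) ∈ termSet β n :=
  termSet_mono (Nat.zero_le n) (Or.inl (Or.inl rfl))

theorem one_mem_termSet (n : ℕ) : (1 : toag.Term β) ∈ termSet β n :=
  termSet_mono (Nat.zero_le n) (Or.inl (Or.inr (Or.inl rfl)))

theorem tau_mem_termSet (n : ℕ) : (tau : toag.Term β) ∈ termSet β n :=
  termSet_mono (Nat.zero_le n) (Or.inl (Or.inr (Or.inr rfl)))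

theorem var_mem_termSet (i : β) (n : ℕ) : (.var i : toag.Term β) ∈ termSet β n :=
  termSet_mono (Nat.zero_le n) (Or.inr ⟨i, rfl⟩)

end TermSet

section Represented

variable {M N : Type*} [TruncOps M] [TruncOps N] {a : β → M} {b : β → N} {n : ℕ}
  {p q : GroupExt M × GroupExt N}

/-- The values of the terms in `S` are ordered in the same way at `a` and at `b`. -/
def OrderAgree (S : Set (toag.Term β)) (a : β → M) (b : β → N) : Prop :=
  ∀ s ∈ S, ∀ t ∈ S, s.realize a ≤ t.realize a ↔ s.realize b ≤ t.realize b

theorem OrderAgree.lt_top_iff (h : OrderAgree (termSet β n) a b) {t : toag.Term β}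
    (ht : t ∈ termSet β n) : t.realize a < ⊤ ↔ t.realize b < ⊤ := by
  rw [← not_le, ← not_le]
  exact (h tau (tau_mem_termSet n) t ht).not

/-- The two components have the same number of multiples of `τ`, and their remainders are the
values of a common term in `S`. -/
def Represented (S : Set (toag.Term β)) (a : β → M) (b : β → N)
    (p : GroupExt M × GroupExt N) : Prop :=
  p.1.coeff = p.2.coeff ∧ ∃ s ∈ S, s.realize a = p.1.rest ∧ s.realize b = p.2.rest

theorem Represented.mono {m : ℕ} (hp : Represented (termSet β m) a b p) (h : m ≤ n) :
    Represented (termSet β n) a b p := by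
  obtain ⟨coeff_eq, s, hs, hsp⟩ := hp
  exact ⟨coeff_eq, s, termSet_mono h hs, hsp⟩

variable [IsTOAG M] [IsTOAG N]

theorem OrderAgree.eq_zero_iff (h : OrderAgree (termSet β n) a b) {t : toag.Term β}
    (ht : t ∈ termSet β n) : t.realize a = 0 ↔ t.realize b = 0 := by
  rw [← nonpos_iff_eq_zero, ← nonpos_iff_eq_zero]
  exact h t ht 0 (zero_mem_termSet n)

theorem Represented.add (h : OrderAgree (termSet β (n + 1)) a b)
    (hp : Represented (termSet β n) a b p) (hq : Represented (termSet β n) a b q) :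
    Represented (termSet β (n + 2)) a b (p + q) := by
  obtain ⟨⟨j, x, hx⟩, ⟨k, y, hy⟩⟩ := p
  obtain ⟨⟨j', x', hx'⟩, ⟨k', y', hy'⟩⟩ := q
  obtain ⟨rfl : j = k, s, hs, rfl : _ = x, rfl : _ = y⟩ := hp
  obtain ⟨rfl : j' = k', t, ht, rfl : _ = x', rfl : _ = y'⟩ := hq
  have lt_top_iff := h.lt_top_iff (add_mem_termSet hs ht)
  simp only [realize_add] at lt_top_iff
  simp only [Represented, Prod.fst_add, Prod.snd_add, coeff_add, rest_add]
  by_cases hlt : s.realize a + t.realize a < ⊤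
  · rw [if_pos hlt, if_pos hlt, if_pos (lt_top_iff.1 hlt), if_pos (lt_top_iff.1 hlt)]
    exact ⟨rfl, s + t, termSet_mono (Nat.le_succ _) (add_mem_termSet hs ht), rfl, rfl⟩
  · rw [if_neg hlt, if_neg hlt, if_neg (lt_top_iff.not.1 hlt), if_neg (lt_top_iff.not.1 hlt)]
    exact ⟨rfl, t ∸ (tau ∸ s), monus_mem_termSet (termSet_mono (Nat.le_succ _) ht)
      (monus_mem_termSet (tau_mem_termSet n) hs), rfl, rfl⟩

variable [Nontrivial M] [Nontrivial N]

theorem represented_zero (n : ℕ) :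
    Represented (termSet β n) a b (0 : GroupExt M × GroupExt N) :=
  ⟨rfl, 0, zero_mem_termSet n, rfl, rfl⟩

theorem OrderAgree.represented_of (h : OrderAgree (termSet β n) a b) {t : toag.Term β}
    (ht : t ∈ termSet β n) :
    Represented (termSet β n) a b (of (t.realize a), of (t.realize b)) := by
  rcases eq_top_or_lt_top (t.realize a) with ha | ha
  · have hb : t.realize b = ⊤ := not_lt_top_iff.1 ((h.lt_top_iff ht).not.1 ha.not_lt)
    rw [ha, hb, of_top, of_top]
    exact ⟨rfl, 0, zero_mem_termSet n, rfl, rfl⟩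
  · rw [of_of_lt_top ha, of_of_lt_top ((h.lt_top_iff ht).1 ha)]
    exact ⟨rfl, t, ht, rfl, rfl⟩

theorem Represented.neg (h : OrderAgree (termSet β n) a b)
    (hp : Represented (termSet β n) a b p) : Represented (termSet β (n + 1)) a b (-p) := by
  obtain ⟨⟨j, x, hx⟩, ⟨k, y, hy⟩⟩ := p
  obtain ⟨rfl : j = k, s, hs, rfl : _ = x, rfl : _ = y⟩ := hp
  simp only [Represented, Prod.fst_neg, Prod.snd_neg, coeff_neg, rest_neg]
  by_cases h0 : s.realize a = 0
  · rw [if_pos h0, if_pos h0, if_pos ((h.eq_zero_iff hs).1 h0), if_pos ((h.eq_zero_iff hs).1 h0)]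
    exact ⟨rfl, 0, zero_mem_termSet _, rfl, rfl⟩
  · have h0' := (h.eq_zero_iff hs).not.1 h0
    rw [if_neg h0, if_neg h0, if_neg h0', if_neg h0']
    exact ⟨rfl, tau ∸ s, monus_mem_termSet (tau_mem_termSet n) hs, rfl, rfl⟩

end Represented

variable {M : Type u} {N : Type v} [TruncOps M] [IsPresTOAG M] [TruncOps N] [IsPresTOAG N]
  {a : β → M} {b : β → N} {n K : ℕ} {p : GroupExt M × GroupExt N}

theorem represented_of_mem_ball (h : OrderAgree (termSet β (2 * K + 1)) a b)
    (hp : p ∈ ball (pairSet a b) K) : Represented (termSet β (2 * K + 1)) a b p := by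
  have agree {m : ℕ} (hm : m ≤ 2 * K + 1) : OrderAgree (termSet β m) a b :=
    fun s hs t ht => h s (termSet_mono hm hs) t (termSet_mono hm ht)
  have represented_pairSet {e} (he : e ∈ pairSet a b) : Represented (termSet β 0) a b e := by
    rcases he with (rfl | rfl) | ⟨i, rfl⟩
    · exact (agree (Nat.zero_le _)).represented_of (one_mem_termSet 0)
    · exact (agree (Nat.zero_le _)).represented_of (tau_mem_termSet 0)
    · exact (agree (Nat.zero_le _)).represented_of (var_mem_termSet i 0)
  suffices H : ∀ J ≤ K, ∀ p ∈ ball (pairSet a b) J, Represented (termSet β (2 * J + 1)) a b p from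
    H K le_rfl p hp
  intro J
  induction J with
  | zero =>
    rintro - _ rfl
    exact represented_zero _
  | succ J ih =>
    rintro hJ _ ⟨q, hq, e, he, rfl⟩
    refine Represented.add (n := 2 * J + 1) (agree (by omega)) (ih (by omega) q hq) ?_
    rcases he with rfl | he | he
    · exact represented_zero _
    · exact (represented_pairSet he).mono (by omega)
    · rw [← neg_neg e]
      exact ((represented_pairSet he).neg (agree (by omega))).mono (by omega)

theorem exists_lt_congMod_nsmul_one (hn : 0 < n) (x : M) :
    ∃ r < n, r • of (1 : M) ≤ of ⊤ ∧ CongMod n x (r • 1) := by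
  obtain ⟨r, hr, h, e⟩ := (isPresburgerUnit (M := M)).exists_lt_eq_nsmul_add_nsmul hn (of x)
  have h_nonneg : 0 ≤ h := by
    by_contra! h_neg
    have h_le : n • h ≤ -(n • of (1 : M)) := by
      rw [← smul_neg]
      exact nsmul_le_nsmul_right
        (le_neg_of_le_neg (isPresburgerUnit.le_of_pos (-h) (neg_pos.2 h_neg))) n
    refine (of_nonneg x).not_gt ?_
    calc of x = r • of 1 + n • h := e
      _ < n • of 1 + -(n • of 1) :=
        add_lt_add_of_lt_of_le (nsmul_lt_nsmul_left isPresburgerUnit.pos hr) h_le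
      _ = 0 := add_neg_cancel _
  have le_top : r • of (1 : M) ≤ of ⊤ := by
    refine le_trans ?_ (of_le_top x)
    rw [e]
    exact le_add_of_nonneg_right (nsmul_nonneg h_nonneg n)
  refine ⟨r, hr, le_top, h, ?_⟩
  rw [of_nsmul_eq_min, min_eq_left le_top, e, add_sub_cancel_left]

theorem of_mem_residueSubgroup_of_congMod {x : M} {y : N} {r : ℕ} (hM : r • of (1 : M) ≤ of ⊤)
    (hN : r • of (1 : N) ≤ of ⊤) (hx : CongMod n x (r • 1)) (hy : CongMod n y (r • 1)) :
    (of x, of y) ∈ residueSubgroup ((of 1, of 1) : GroupExt M × GroupExt N) n := by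
  obtain ⟨h, hx⟩ := hx
  obtain ⟨k, hy⟩ := hy
  rw [of_nsmul_eq_min, min_eq_left hM, sub_eq_iff_eq_add'] at hx
  rw [of_nsmul_eq_min, min_eq_left hN, sub_eq_iff_eq_add'] at hy
  refine mem_residueSubgroup.2 ⟨r, (h, k), ?_⟩
  rw [natCast_zsmul, hx, hy]
  rfl

theorem of_mem_residueSubgroup_of_congMod_iff (hn : 0 < n) {x : M} {y : N}
    (h : ∀ m < n, CongMod n x (m • 1) ↔ CongMod n y (m • 1)) :
    (of x, of y) ∈ residueSubgroup ((of 1, of 1) : GroupExt M × GroupExt N) n := by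
  obtain ⟨r, hr, r_le_top, hx⟩ := exists_lt_congMod_nsmul_one hn x
  obtain ⟨s, hs, s_le_top, hy⟩ := exists_lt_congMod_nsmul_one hn y
  rcases le_total r s with hrs | hsr
  · exact of_mem_residueSubgroup_of_congMod r_le_top
      ((nsmul_le_nsmul_left (isPresburgerUnit (M := N)).pos.le hrs).trans s_le_top) hx
      ((h r hr).1 hx)
  · exact of_mem_residueSubgroup_of_congMod
      ((nsmul_le_nsmul_left (isPresburgerUnit (M := M)).pos.le hsr).trans r_le_top) s_le_top
      ((h s hs).2 hy) hy

theorem similarTuples_of_orderAgree (h : OrderAgree (termSet β (2 * K + 1)) a b)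
    (hres : ∀ t ∈ termSet β 0, ∀ n, 0 < n → n ≤ K → ∀ m < n,
      CongMod n (t.realize a) (m • 1) ↔ CongMod n (t.realize b) (m • 1)) :
    SimilarTuples a b K := by
  refine ⟨fun p hp => ?_, ?_⟩
  · rw [nonneg_iff, nonneg_iff, (represented_of_mem_ball h hp).1]
  · rintro n hn hnK _ ((rfl | rfl) | ⟨i, rfl⟩)
    · exact self_mem_residueSubgroup
    · exact of_mem_residueSubgroup_of_congMod_iff hn (hres tau (tau_mem_termSet 0) n hn hnK)
    · exact of_mem_residueSubgroup_of_congMod_iff hn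
        (hres (.var i) (var_mem_termSet i 0) n hn hnK)

end AtomicCriterion

section TypeFormulas

variable {L : FirstOrder.Language} {α β ι : Type*} [Finite β] [Finite ι] {n : ℕ}

theorem isQF_iInf {f : β → L.BoundedFormula α n} (h : ∀ b, (f b).IsQF) :
    (BoundedFormula.iInf f).IsQF := by
  rw [BoundedFormula.iInf]
  generalize (@Finset.univ β (Fintype.ofFinite β)).toList = l
  induction l with
  | nil => exact BoundedFormula.isQF_bot.imp BoundedFormula.isQF_bot
  | cons a l ih => exact (h a).inf ih

theorem isQF_iSup {f : β → L.BoundedFormula α n} (h : ∀ b, (f b).IsQF) :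
    (BoundedFormula.iSup f).IsQF := by
  rw [BoundedFormula.iSup]
  generalize (@Finset.univ β (Fintype.ofFinite β)).toList = l
  induction l with
  | nil => exact BoundedFormula.isQF_bot
  | cons a l ih => exact (h a).sup ih

open Classical in
/-- The formula saying that `σ` is exactly the set of the `δ i` that hold. -/
noncomputable def typeFormula (δ : ι → L.Formula α) (σ : Set ι) : L.Formula α :=
  Formula.iInf fun i => if i ∈ σ then δ i else (δ i).not

theorem isQF_typeFormula {δ : ι → L.Formula α} (hδ : ∀ i, BoundedFormula.IsQF (δ i))
    (σ : Set ι) : BoundedFormula.IsQF (typeFormula δ σ) := by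
  refine isQF_iInf fun i => ?_
  split_ifs
  · exact hδ i
  · exact (hδ i).not

theorem realize_typeFormula {δ : ι → L.Formula α} {σ : Set ι} {M : Type*} [L.Structure M]
    {v : α → M} : (typeFormula δ σ).Realize v ↔ ∀ i, i ∈ σ ↔ (δ i).Realize v := by
  rw [typeFormula, Formula.realize_iInf]
  refine forall_congr' fun i => ?_
  split_ifs with hi
  · exact (iff_true_left hi).symm
  · exact (Formula.realize_not).trans (iff_false_left hi).symm

end TypeFormulas

theorem exists_isQF_of_forall_realize_imp {L : FirstOrder.Language.{u, v}} {T : L.Theory}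
    {α : Type w} {ι : Type*} [Finite ι] (φ : L.Formula α) {δ : ι → L.Formula α}
    (hδ : ∀ i, BoundedFormula.IsQF (δ i))
    (h : ∀ (M N : Theory.ModelType.{u, v, max u v w} T) (v : α → M) (w : α → N),
      (∀ i, (δ i).Realize v ↔ (δ i).Realize w) → φ.Realize v → φ.Realize w) :
    ∃ ψ : L.Formula α, BoundedFormula.IsQF ψ ∧ T ⊨ᵇ BoundedFormula.iff φ ψ := by
  let consistentTypes : Set (Set ι) :=
    {σ | ∃ (M : Theory.ModelType.{u, v, max u v w} T) (v : α → M),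
      φ.Realize v ∧ (typeFormula δ σ).Realize v}
  refine ⟨Formula.iSup fun σ : consistentTypes => typeFormula δ σ.1,
    isQF_iSup fun σ => isQF_typeFormula hδ σ.1, fun M v xs => ?_⟩
  obtain rfl : xs = default := Subsingleton.elim _ _
  rw [BoundedFormula.realize_iff, ← Formula.Realize, ← Formula.Realize, Formula.realize_iSup]
  constructor
  · intro hφ
    have realize_type : (typeFormula δ {i | (δ i).Realize v}).Realize v :=
      realize_typeFormula.2 fun i => Iff.rfl
    exact ⟨⟨_, M, v, hφ, realize_type⟩, realize_type⟩
  · rintro ⟨⟨σ, N, w, hφ, hw⟩, hv⟩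
    exact h N M w v (fun i => (realize_typeFormula.1 hw i).symm.trans
      (realize_typeFormula.1 hv i)) hφ

section AtomicFormulas

variable {α : Type*} {M : Type*} [TruncOps M] [IsPresTOAG M]

/-- The atomic formula `s ≤ t` of the language with congruences. -/
def leFormula (s t : toag.Term α) : toagCong.Formula α :=
  (toagIncl.onRelation (ToagRel.le : toag.Relations 2)).formula₂ (toagIncl.onTerm s)
    (toagIncl.onTerm t)

/-- The atomic formula `t ≡ m (mod n)` of the language with congruences. -/
def residueFormula (n : ℕ) (hn : 2 ≤ n) (t : toag.Term α) (m : ℕ) : toagCong.Formula α :=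
  (congSymb n hn).formula₂ (toagIncl.onTerm t) (toagIncl.onTerm (mult m 1))

theorem realize_leFormula {s t : toag.Term α} {v : α → M} :
    (leFormula s t).Realize v ↔ s.realize v ≤ t.realize v := by
  rw [leFormula, Formula.realize_rel₂, LHom.realize_onTerm, LHom.realize_onTerm]
  rfl

theorem realize_residueFormula {n : ℕ} {hn : 2 ≤ n} {t : toag.Term α} {m : ℕ} {v : α → M} :
    (residueFormula n hn t m).Realize v ↔ CongMod n (t.realize v) (m • 1) := by
  rw [residueFormula, Formula.realize_rel₂, LHom.realize_onTerm, LHom.realize_onTerm,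
    realize_mult]
  rfl

/-- The atomic formulas that determine the tuples up to similarity of order `K`. -/
def atomicSet (α : Type*) (K : ℕ) : Set (toagCong.Formula α) :=
  Set.image2 leFormula (termSet α (2 * K + 1)) (termSet α (2 * K + 1)) ∪
    ⋃ n : Finset.Icc 2 K, Set.image2 (residueFormula n (Finset.mem_Icc.1 n.2).1) (termSet α 0)
      (Set.Iio n)

theorem finite_atomicSet [Finite α] (K : ℕ) : (atomicSet α K).Finite :=
  ((finite_termSet _).image2 _ (finite_termSet _)).union <|
    Set.finite_iUnion fun _ => (finite_termSet _).image2 _ (Set.finite_Iio _)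

theorem isQF_of_mem_atomicSet {K : ℕ} {δ : toagCong.Formula α} (h : δ ∈ atomicSet α K) :
    BoundedFormula.IsQF δ := by
  rcases h with ⟨s, -, t, -, rfl⟩ | h
  · exact (BoundedFormula.IsAtomic.rel _ _).isQF
  · obtain ⟨n, t, -, m, -, rfl⟩ := Set.mem_iUnion.1 h
    exact (BoundedFormula.IsAtomic.rel _ _).isQF

end AtomicFormulas

theorem similarTuples_of_atomicSet {α : Type*} {M : Type u} {N : Type v} [TruncOps M]
    [IsPresTOAG M] [TruncOps N] [IsPresTOAG N] {v : α → M} {w : α → N} {K : ℕ}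
    (h : ∀ δ ∈ atomicSet α K, δ.Realize v ↔ δ.Realize w) : SimilarTuples v w K := by
  refine similarTuples_of_orderAgree (fun s hs t ht => ?_) fun t ht n hn hnK m hm => ?_
  · rw [← realize_leFormula, ← realize_leFormula]
    exact h _ (Or.inl ⟨s, hs, t, ht, rfl⟩)
  · obtain rfl | hn2 : n = 1 ∨ 2 ≤ n := by omega
    · exact iff_of_true ⟨_, (one_smul _ _).symm⟩ ⟨_, (one_smul _ _).symm⟩
    · rw [← realize_residueFormula (hn := hn2), ← realize_residueFormula (hn := hn2)]
      exact h _ (Or.inr (Set.mem_iUnion.2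
        ⟨⟨n, Finset.mem_Icc.2 ⟨hn2, hnK⟩⟩, t, ht, m, hm, rfl⟩))

theorem realize_iff_of_atomicSet {α : Type*} [Finite α] {M : Type u} {N : Type v}
    [toagCong.Structure M] [toagCong.Structure N] (hM : M ⊨ presTOAGCong) (hN : N ⊨ presTOAGCong)
    (φ : toagCong.Formula α) {v : α → M} {w : α → N}
    (h : ∀ δ ∈ atomicSet α (depth φ), δ.Realize v ↔ δ.Realize w) : φ.Realize v ↔ φ.Realize w := by
  obtain ⟨_, _, rfl⟩ := exists_truncOps_of_model_presTOAGCong hM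
  obtain ⟨_, _, rfl⟩ := exists_truncOps_of_model_presTOAGCong hN
  exact (similarTuples_of_atomicSet h).realize_formula_iff φ

theorem hasQE_presTOAGCong : HasQE presTOAGCong := by
  intro n φ
  have : Finite (atomicSet (Fin n) (depth φ)) := finite_atomicSet _
  exact exists_isQF_of_forall_realize_imp φ
    (fun δ : atomicSet (Fin n) (depth φ) => isQF_of_mem_atomicSet δ.2) fun M N v w h =>
    (realize_iff_of_atomicSet M.is_model N.is_model φ fun δ hδ => h ⟨δ, hδ⟩).1

/-! ### Models and their residues -/

section OrderedGroup

variable {G : Type*} [AddCommGroup G] [LinearOrder G] [IsOrderedAddMonoid G] {u t : G}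

theorem zsmul_add_zsmul_pos (ht : ∀ m : ℤ, m • u < t) {k : ℤ} (hk : 0 < k) (m : ℤ) :
    0 < k • t + m • u := by
  have t_pos : 0 < t := zero_smul ℤ u ▸ ht 0
  have t_le : t ≤ k • t := by
    simpa only [one_smul] using zsmul_le_zsmul_left t_pos.le (show 1 ≤ k from hk)
  calc 0 < t + m • u := by simpa only [neg_smul, neg_lt_iff_pos_add] using ht (-m)
    _ ≤ k • t + m • u := add_le_add_left t_le _

theorem zsmul_add_zsmul_nonneg_iff (hu : 0 < u) (ht : ∀ m : ℤ, m • u < t) (k m : ℤ) :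
    0 ≤ k • t + m • u ↔ 0 < k ∨ k = 0 ∧ 0 ≤ m := by
  rcases lt_trichotomy k 0 with h | rfl | h
  · have := zsmul_add_zsmul_pos ht (neg_pos.2 h) (-m)
    rw [neg_smul, neg_smul, ← neg_add, neg_pos] at this
    exact iff_of_false this.not_ge (by omega)
  · rw [zero_smul, zero_add, ← zero_smul ℤ u, zsmul_le_zsmul_iff_left hu]
    simp only [lt_irrefl, true_and, false_or]
  · exact iff_of_true (zsmul_add_zsmul_pos ht h m).le (Or.inl h)

end OrderedGroup

theorem zHat_ext {f g : ZHat} (h : ∀ (p : Nat.Primes) (k : ℕ), 1 ≤ k →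
    PadicInt.toZModPow k (f p) = PadicInt.toZModPow k (g p)) : f = g := by
  funext p
  refine PadicInt.ext_of_toZModPow.1 fun k => ?_
  rcases Nat.eq_zero_or_pos k with rfl | hk
  · exact Subsingleton.elim (α := ZMod 1) _ _
  · exact h p k hk

section Models

open GroupExt

variable {M : Type u} {N : Type v} [TruncOps M] [IsPresTOAG M] [TruncOps N] [IsPresTOAG N]
  {n q : ℕ} {f g : ZHat}

theorem nsmul_one_lt_top_of_infinite [Infinite M] (m : ℕ) : m • of (1 : M) < of ⊤ := by
  by_contra! h
  have mem_range (a : M) : of a ∈ (fun j : ℕ => j • of (1 : M)) '' Set.Iic m := by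
    obtain ⟨j, hj, e⟩ :=
      isPresburgerUnit.exists_eq_nsmul_of_le (of_nonneg a) ((of_le_top a).trans h)
    exact ⟨j, hj, e.symm⟩
  have : (Set.range (of : M → GroupExt M)).Finite :=
    ((Set.finite_Iic m).image _).subset (Set.range_subset_iff.2 mem_range)
  exact Set.infinite_range_of_injective of_injective this

theorem exists_top_eq_of_finite [Finite M] : ∃ n : ℕ, 1 ≤ n ∧ of (⊤ : M) = n • of 1 := by
  obtain ⟨m, hm⟩ : ∃ m : ℕ, of (⊤ : M) ≤ m • of 1 := by
    by_contra! h
    refine not_injective_infinite_finite (fun m : ℕ => m • (1 : M)) fun a b hab => ?_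
    have e : of (a • (1 : M)) = of (b • (1 : M)) := congrArg of hab
    rw [of_nsmul_eq_min, of_nsmul_eq_min, min_eq_left (h a).le, min_eq_left (h b).le] at e
    exact (nsmul_left_strictMono isPresburgerUnit.pos).injective e
  obtain ⟨n, -, e⟩ := isPresburgerUnit.exists_eq_nsmul_of_le (of_nonneg _) hm
  refine ⟨n, Nat.one_le_iff_ne_zero.2 ?_, e⟩
  rintro rfl
  rw [zero_smul] at e
  exact (isPresburgerUnit.pos.trans_le (of_le_top (1 : M))).ne' e

theorem zsmul_add_nonneg_iff_of_infinite [Infinite M] (k m : ℤ) :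
    0 ≤ k • of (⊤ : M) + m • of 1 ↔ 0 < k ∨ k = 0 ∧ 0 ≤ m := by
  have one_pos := (isPresburgerUnit (M := M)).pos
  refine zsmul_add_zsmul_nonneg_iff one_pos (fun m => ?_) k m
  calc m • of (1 : M) ≤ (m.toNat : ℤ) • of 1 :=
        zsmul_le_zsmul_left one_pos.le (Int.self_le_toNat m)
    _ < of ⊤ := natCast_zsmul (of (1 : M)) _ ▸ nsmul_one_lt_top_of_infinite _

theorem zsmul_add_nonneg_iff_of_top_eq (h : of (⊤ : M) = n • of 1) (k m : ℤ) :
    0 ≤ k • of (⊤ : M) + m • of 1 ↔ 0 ≤ k * n + m := by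
  rw [h, ← natCast_zsmul, smul_smul, ← add_smul, ← zero_smul ℤ (of (1 : M)),
    zsmul_le_zsmul_iff_left isPresburgerUnit.pos]

theorem similarTuples_of_isEmpty {β : Type*} [IsEmpty β] {a : β → M} {b : β → N}
    (hsign : ∀ k m : ℤ, 0 ≤ k • of (⊤ : M) + m • of 1 ↔ 0 ≤ k • of (⊤ : N) + m • of 1)
    (hres : ∀ n, 0 < n →
      (of ⊤, of ⊤) ∈ residueSubgroup ((of 1, of 1) : GroupExt M × GroupExt N) n) (K : ℕ) :
    SimilarTuples a b K := by
  have pairSet_eq : pairSet a b = {(of 1, of 1), (of ⊤, of ⊤)} := by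
    rw [pairSet, Set.range_eq_empty, Set.union_empty]
  refine ⟨fun p hp => ?_, fun n hn _ => ?_⟩
  · rw [pairSet_eq] at hp
    obtain ⟨m, k, rfl⟩ := AddSubgroup.mem_closure_pair.1
      (ball_subset_addSubgroup AddSubgroup.subset_closure hp)
    rw [add_comm]
    exact hsign k m
  · rw [pairSet_eq]
    exact Set.insert_subset self_mem_residueSubgroup (Set.singleton_subset_iff.2 (hres n hn))

theorem elementarilyEquivalent_of_sign_of_residue
    (hsign : ∀ k m : ℤ, 0 ≤ k • of (⊤ : M) + m • of 1 ↔ 0 ≤ k • of (⊤ : N) + m • of 1)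
    (hres : ∀ n, 0 < n →
      (of ⊤, of ⊤) ∈ residueSubgroup ((of 1, of 1) : GroupExt M × GroupExt N) n) :
    M ≅[toag] N := by
  refine elementarilyEquivalent_iff.2 fun φ => ?_
  have := SimilarTuples.realize_formula_iff (toagIncl.onFormula φ)
    (similarTuples_of_isEmpty (a := default) (b := default) hsign hres _)
  rwa [LHom.realize_onFormula, LHom.realize_onFormula] at this

theorem top_mem_residueSubgroup_of_residueAxioms (hM : M ⊨ residueAxioms f)
    (hN : N ⊨ residueAxioms f) (hn : 0 < n) :
    (of ⊤, of ⊤) ∈ residueSubgroup ((of 1, of 1) : GroupExt M × GroupExt N) n := by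
  induction n using Nat.recOnPosPrimePosCoprime with
  | prime_pow p k hp hk =>
    have hM := hM.realize_of_mem _ ⟨⟨p, hp⟩, k, hk, rfl⟩
    have hN := hN.realize_of_mem _ ⟨⟨p, hp⟩, k, hk, rfl⟩
    rw [realize_tauResidue (Nat.one_le_pow _ _ hp.pos)] at hM hN
    obtain ⟨-, h, hM⟩ := hM
    obtain ⟨-, h', hN⟩ := hN
    rw [sub_eq_iff_eq_add'.1 hM, sub_eq_iff_eq_add'.1 hN]
    exact add_mem (nsmul_mem self_mem_residueSubgroup _) (nsmul_mem_residueSubgroup (h, h'))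
  | zero => exact absurd hn (lt_irrefl 0)
  | one => simpa only [one_smul] using nsmul_mem_residueSubgroup (n := 1) (of (⊤ : M), of (⊤ : N))
  | coprime a b ha hb hab iha ihb =>
    exact mem_residueSubgroup_mul_of_coprime hab (iha (by omega)) (ihb (by omega))

theorem elementarilyEquivalent_of_infinite [Infinite M] [Infinite N] (hM : M ⊨ residueAxioms f)
    (hN : N ⊨ residueAxioms f) : M ≅[toag] N := by
  refine elementarilyEquivalent_of_sign_of_residue (fun k m => ?_)
    fun _ => top_mem_residueSubgroup_of_residueAxioms hM hN
  rw [zsmul_add_nonneg_iff_of_infinite, zsmul_add_nonneg_iff_of_infinite]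

theorem elementarilyEquivalent_of_top_eq (hM : of (⊤ : M) = n • of 1)
    (hN : of (⊤ : N) = n • of 1) : M ≅[toag] N := by
  refine elementarilyEquivalent_of_sign_of_residue (fun k m => ?_) fun q _ => ?_
  · rw [zsmul_add_nonneg_iff_of_top_eq hM, zsmul_add_nonneg_iff_of_top_eq hN]
  · rw [hM, hN, ← Prod.smul_mk]
    exact nsmul_mem self_mem_residueSubgroup n

theorem natCast_eq_of_realize_tauResidue {m m' : ℕ} (hq : 0 < q) (h : M ⊨ tauResidue q m)
    (h' : M ⊨ tauResidue q m') : (m : ZMod q) = m' := by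
  obtain ⟨-, k, hk⟩ := (realize_tauResidue hq m).1 h
  obtain ⟨-, k', hk'⟩ := (realize_tauResidue hq m').1 h'
  have := isPresburgerUnit.intCast_eq_of_zsmul_add_eq (r := m) (s := m') (h := k) (k := k') hq
    (by rw [natCast_zsmul, natCast_zsmul, ← hk, ← hk', add_sub_cancel, add_sub_cancel])
  simpa only [Int.cast_natCast] using this

theorem realize_tauResidue_iff_of_top_eq (h : of (⊤ : M) = n • of 1) (hq : 0 < q) (m : ℕ) :
    M ⊨ tauResidue q m ↔ m ≤ n ∧ (n : ZMod q) = m := by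
  rw [realize_tauResidue hq, h, nsmul_le_nsmul_iff_left isPresburgerUnit.pos]
  refine and_congr_right fun hmn => ⟨fun ⟨k, hk⟩ => ?_, fun e => ?_⟩
  · have := isPresburgerUnit.intCast_eq_of_zsmul_add_eq (r := n) (s := m) (h := 0) (k := k) hq
      (by rw [natCast_zsmul, natCast_zsmul, ← hk, smul_zero, add_zero, add_sub_cancel])
    simpa only [Int.cast_natCast] using this
  · obtain ⟨c, hc⟩ := (Nat.modEq_iff_dvd' hmn).1 ((ZMod.natCast_eq_natCast_iff m n q).1 e.symm)
    exact ⟨c • of 1, by rw [sub_eq_iff_eq_add, smul_smul, ← hc, ← add_smul, Nat.sub_add_cancel hmn]⟩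

theorem eq_of_models_residueAxioms (hf : M ⊨ residueAxioms f) (hg : M ⊨ residueAxioms g) :
    f = g := by
  refine zHat_ext fun p k hk => ?_
  have p_pow_pos : 0 < (p : ℕ) ^ k := pow_pos p.2.pos k
  have : NeZero ((p : ℕ) ^ k) := ⟨p_pow_pos.ne'⟩
  have := natCast_eq_of_realize_tauResidue p_pow_pos (hf.realize_of_mem _ ⟨p, k, hk, rfl⟩)
    (hg.realize_of_mem _ ⟨p, k, hk, rfl⟩)
  rwa [ZMod.natCast_zmod_val, ZMod.natCast_zmod_val] at this

theorem eq_natCast_of_top_eq (h : of (⊤ : M) = n • of 1) (hf : M ⊨ residueAxioms f) :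
    f = fun _ => (n : ℤ_[_]) := by
  refine zHat_ext fun p k hk => ?_
  have p_pow_pos : 0 < (p : ℕ) ^ k := pow_pos p.2.pos k
  have : NeZero ((p : ℕ) ^ k) := ⟨p_pow_pos.ne'⟩
  have := (realize_tauResidue_iff_of_top_eq h p_pow_pos _).1
    (hf.realize_of_mem _ ⟨p, k, hk, rfl⟩)
  rw [map_natCast, this.2, ZMod.natCast_zmod_val]

theorem exists_models_residueAxioms [Infinite M] : ∃ f : ZHat, M ⊨ residueAxioms f := by
  choose f hf using fun p : Nat.Primes =>
    (isPresburgerUnit (M := M)).exists_padicInt (p : ℕ) (of (⊤ : M))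
  refine ⟨f, ⟨?_⟩⟩
  rintro _ ⟨p, k, -, rfl⟩
  obtain ⟨h, e⟩ := hf p k
  exact (realize_tauResidue (pow_pos p.2.pos k) _).2
    ⟨(nsmul_one_lt_top_of_infinite _).le, h, sub_eq_iff_eq_add'.2 e⟩

end Models

/-- The truncated group `{0, …, n}`. -/
def FinModel (n : ℕ) : Type := {k : ℕ // k ≤ n}

namespace FinModel

open GroupExt

variable {n : ℕ}

instance : Finite (FinModel n) := Set.finite_Iic n

instance : TruncOps (FinModel n) where
  __ := (inferInstance : LinearOrder {k : ℕ // k ≤ n})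
  zero := ⟨0, Nat.zero_le n⟩
  one := ⟨min 1 n, min_le_right 1 n⟩
  top := ⟨n, le_rfl⟩
  add a b := ⟨min (a.1 + b.1) n, min_le_right _ n⟩
  sub a b := ⟨a.1 - b.1, (Nat.sub_le _ _).trans a.2⟩

theorem val_le (a : FinModel n) : a.1 ≤ n := a.2

theorem val_zero : (0 : FinModel n).1 = 0 := rfl

theorem val_one [NeZero n] : (1 : FinModel n).1 = 1 := min_eq_left (NeZero.pos n)

theorem val_top : (⊤ : FinModel n).1 = n := rfl

theorem val_add (a b : FinModel n) : (a + b).1 = min (a.1 + b.1) n := rfl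

theorem val_sub (a b : FinModel n) : (a - b).1 = a.1 - b.1 := rfl

theorem val_excess (a b : FinModel n) : (excess a b).1 = b.1 - (n - a.1) := rfl

theorem le_iff {a b : FinModel n} : a ≤ b ↔ a.1 ≤ b.1 := Iff.rfl

theorem lt_iff {a b : FinModel n} : a < b ↔ a.1 < b.1 := Iff.rfl

theorem eq_iff {a b : FinModel n} : a = b ↔ a.1 = b.1 := Subtype.ext_iff

theorem card_eq : Nat.card (FinModel n) = n + 1 := by
  rw [show Nat.card (FinModel n) = (Set.Iic n).ncard from rfl, Set.ncard_eq_toFinset_card',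
    Set.toFinset_Iic, Nat.card_Iic]

instance : IsTOAG (FinModel n) := by
  constructor
  case exists_lt_top_add_eq_top =>
    intro x hx
    have := val_le x
    rw [lt_iff, val_zero] at hx
    exact ⟨⟨n - x.1, Nat.sub_le n x.1⟩, show n - x.1 < n by omega,
      eq_iff.2 (show min (x.1 + (n - x.1)) n = n by omega)⟩
  all_goals
    simp only [le_iff, lt_iff, eq_iff, val_zero, val_top, val_add, val_sub, val_excess]
    intro x
    have := val_le x
    try intro y; have := val_le y
    try intro z; have := val_le z
    omega

theorem val_nsmul (k : ℕ) (a : FinModel n) : (k • a).1 = min (k * a.1) n := by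
  induction k with
  | zero => rw [zero_smul, val_zero, zero_mul, Nat.zero_min]
  | succ k ih =>
    rw [succ_nsmul, val_add, ih, Nat.succ_mul]
    omega

variable [NeZero n]

instance : IsPresTOAG (FinModel n) where
  zero_lt_one := by rw [lt_iff, val_zero, val_one]; exact one_pos
  one_le_of_pos hx := by
    rw [lt_iff, val_zero] at hx
    rwa [le_iff, val_one]
  exists_eq_nsmul_add k hk x := by
    obtain ⟨y, hy⟩ : ∃ y : FinModel n, y.1 = x.1 / k :=
      ⟨⟨x.1 / k, (Nat.div_le_self _ _).trans (val_le x)⟩, rfl⟩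
    refine ⟨y, x.1 % k, Nat.mod_lt _ hk, ?_⟩
    rw [eq_iff, val_add, val_nsmul, val_nsmul, val_one, hy]
    have := Nat.div_add_mod x.1 k
    have := val_le x
    omega

theorem of_top : of (⊤ : FinModel n) = n • of 1 := by
  have nsmul_one : n • (1 : FinModel n) = ⊤ := by
    rw [eq_iff, val_nsmul, val_one, val_top, mul_one, min_self]
  have pred_nsmul_one_lt : (n - 1) • (1 : FinModel n) < ⊤ := by
    rw [lt_iff, val_nsmul, val_one, val_top, mul_one]
    exact min_lt_of_left_lt (Nat.sub_one_lt (NeZero.ne n))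
  rw [← nsmul_one, of_nsmul_eq_min, min_eq_left (pred_nsmul_one_lt_top_iff.1 pred_nsmul_one_lt)]

theorem realize_tauEq_iff {m : ℕ} : FinModel n ⊨ tauEq m ↔ n = m := by
  rw [realize_tauEq, of_top, (nsmul_left_strictMono isPresburgerUnit.pos).injective.eq_iff]

theorem realize_tauResidue_iff {q : ℕ} (hq : 0 < q) (m : ℕ) :
    FinModel n ⊨ tauResidue q m ↔ m ≤ n ∧ (n : ZMod q) = m :=
  realize_tauResidue_iff_of_top_eq of_top hq m

theorem model_presTOAG : FinModel n ⊨ presTOAG :=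
  model_presTOAG_iff.2 inferInstance

end FinModel

/-! ### Completions -/

/-- The theory of the infinite models in which `τ` has the residues of `f`. -/
noncomputable abbrev infiniteResidueTheory (f : ZHat) : toag.Theory :=
  presTOAG ∪ toag.infiniteTheory ∪ residueAxioms f

theorem model_infiniteResidueTheory_iff {f : ZHat} {M : Type*} [toag.Structure M] :
    M ⊨ infiniteResidueTheory f ↔ M ⊨ presTOAG ∧ Infinite M ∧ M ⊨ residueAxioms f := by
  rw [Theory.model_union_iff, Theory.model_union_iff, model_infiniteTheory_iff, and_assoc]

section Satisfiability

/-- The natural number `n` approximates `f` up to `B`: it exceeds `B`, and it agrees with `f` modulo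
`p ^ k` whenever `p, k ≤ B`. -/
structure Approximates (f : ZHat) (B n : ℕ) : Prop where
  lt : B < n
  toZModPow_eq : ∀ p : Nat.Primes, (p : ℕ) ≤ B → ∀ k ≤ B, PadicInt.toZModPow k (f p) = n

variable {f : ZHat}

theorem Approximates.mono {B B' n : ℕ} (h : Approximates f B n) (hB : B' ≤ B) :
    Approximates f B' n :=
  ⟨hB.trans_lt h.lt, fun p hp k hk => h.toZModPow_eq p (hp.trans hB) k (hk.trans hB)⟩

theorem toZModPow_eq_natCast_of_le {p k l n : ℕ} [Fact p.Prime] {x : ℤ_[p]} (hkl : k ≤ l)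
    (h : PadicInt.toZModPow l x = n) : PadicInt.toZModPow k x = n := by
  rw [← PadicInt.cast_toZModPow k l hkl, h, ZMod.cast_natCast (pow_dvd_pow p hkl)]

theorem exists_approximates (f : ZHat) (B : ℕ) : ∃ n, Approximates f B n := by
  have hfin : {p : Nat.Primes | (p : ℕ) ≤ B}.Finite :=
    (Set.finite_Iic B).preimage Nat.Primes.coe_nat_injective.injOn
  let s : Nat.Primes → ℕ := fun p => (p : ℕ) ^ B
  have s_ne_zero : ∀ p ∈ hfin.toFinset, s p ≠ 0 := fun p _ => pow_ne_zero _ p.2.ne_zero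
  have s_coprime : Set.Pairwise hfin.toFinset (Function.onFun Nat.Coprime s) :=
    fun p _ q _ hpq =>
      ((Nat.coprime_primes p.2 q.2).2 fun e => hpq (Subtype.ext e)).pow _ _
  obtain ⟨r, hr⟩ := Nat.chineseRemainderOfFinset
    (fun p : Nat.Primes => (PadicInt.toZModPow B (f p)).val) s hfin.toFinset s_ne_zero s_coprime
  have prod_pos : 0 < ∏ p ∈ hfin.toFinset, s p :=
    Nat.pos_of_ne_zero (Finset.prod_ne_zero_iff.2 s_ne_zero)
  refine ⟨r + (B + 1) * ∏ p ∈ hfin.toFinset, s p, ?_, fun p hp k hk => ?_⟩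
  · calc B < (B + 1) * 1 := by omega
      _ ≤ (B + 1) * ∏ p ∈ hfin.toFinset, s p := Nat.mul_le_mul_left _ prod_pos
      _ ≤ _ := Nat.le_add_left _ _
  · refine toZModPow_eq_natCast_of_le hk ?_
    have p_mem : p ∈ hfin.toFinset := hfin.mem_toFinset.2 hp
    have : NeZero ((p : ℕ) ^ B) := ⟨s_ne_zero p p_mem⟩
    have r_eq := (ZMod.natCast_eq_natCast_iff _ _ _).2 (hr p p_mem)
    have prod_eq : ((∏ p ∈ hfin.toFinset, s p : ℕ) : ZMod ((p : ℕ) ^ B)) = 0 :=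
      (ZMod.natCast_eq_zero_iff _ _).2 (Finset.dvd_prod_of_mem s p_mem)
    rw [Nat.cast_add, Nat.cast_mul, prod_eq, mul_zero, add_zero, r_eq, ZMod.natCast_zmod_val]

theorem exists_realize_of_approximates {φ : toag.Sentence} (hφ : φ ∈ infiniteResidueTheory f) :
    ∃ B, ∀ n, Approximates f B n → FinModel n ⊨ φ := by
  rcases hφ with (hφ | ⟨k, rfl⟩) | ⟨p, k, hk, rfl⟩
  · refine ⟨0, fun n h => ?_⟩
    have : NeZero n := ⟨h.lt.ne'⟩
    exact FinModel.model_presTOAG.realize_of_mem _ hφ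
  · refine ⟨k, fun n h => ?_⟩
    rw [Sentence.realize_cardGe, ← Nat.cast_card, FinModel.card_eq, Nat.cast_le]
    exact h.lt.le.trans n.le_succ
  · refine ⟨(p : ℕ) ^ k, fun n h => ?_⟩
    have p_pow_pos : 0 < (p : ℕ) ^ k := pow_pos p.2.pos k
    have : NeZero n := ⟨(p_pow_pos.trans h.lt).ne'⟩
    have : NeZero ((p : ℕ) ^ k) := ⟨p_pow_pos.ne'⟩
    rw [FinModel.realize_tauResidue_iff p_pow_pos, ZMod.natCast_zmod_val]
    exact ⟨((ZMod.val_lt _).trans h.lt).le, (h.toZModPow_eq p (Nat.le_self_pow (by omega) _) k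
      (Nat.lt_pow_self p.2.one_lt).le).symm⟩

theorem isSatisfiable_infiniteResidueTheory (f : ZHat) :
    (infiniteResidueTheory f).IsSatisfiable := by
  rw [Theory.isSatisfiable_iff_isFinitelySatisfiable]
  intro T hT
  choose! B hB using fun φ => exists_realize_of_approximates (f := f) (φ := φ)
  obtain ⟨n, hn⟩ := exists_approximates f (T.sup B)
  have : FinModel n ⊨ (T : toag.Theory) :=
    ⟨fun φ hφ => hB φ (hT hφ) n (hn.mono (Finset.le_sup hφ))⟩
  exact Theory.Model.isSatisfiable (FinModel n)

end Satisfiability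

section ModelsOfTheories

open GroupExt

variable {M N : Type} [toag.Structure M] [toag.Structure N] {f g : ZHat} {n : ℕ}

theorem elementarilyEquivalent_of_models_infiniteResidueTheory (hM : M ⊨ infiniteResidueTheory f)
    (hN : N ⊨ infiniteResidueTheory f) : M ≅[toag] N := by
  obtain ⟨hM, _, hfM⟩ := model_infiniteResidueTheory_iff.1 hM
  obtain ⟨hN, _, hfN⟩ := model_infiniteResidueTheory_iff.1 hN
  obtain ⟨_, rfl, _⟩ := exists_truncOps_of_model hM
  obtain ⟨_, rfl, _⟩ := exists_truncOps_of_model hN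
  exact elementarilyEquivalent_of_infinite hfM hfN

theorem infinite_of_models_residueAxioms (hf : ¬ ∃ n : ℕ, 1 ≤ n ∧ ∀ p, f p = n)
    (hM : M ⊨ presTOAG ∪ residueAxioms f) : Infinite M := by
  obtain ⟨hM, hfM⟩ := Theory.model_union_iff.1 hM
  obtain ⟨_, rfl, _⟩ := exists_truncOps_of_model hM
  by_contra h
  have := not_infinite_iff_finite.1 h
  obtain ⟨n, hn, e⟩ := exists_top_eq_of_finite (M := M)
  exact hf ⟨n, hn, congrFun (eq_natCast_of_top_eq e hfM)⟩

theorem model_presTOAG_union_tauEq_iff : M ⊨ presTOAG ∪ {tauEq n} ↔ M ⊨ presTOAG ∧ M ⊨ tauEq n := by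
  rw [Theory.model_union_iff, Theory.model_singleton_iff]

theorem elementarilyEquivalent_of_models_tauEq (hM : M ⊨ presTOAG ∪ {tauEq n})
    (hN : N ⊨ presTOAG ∪ {tauEq n}) : M ≅[toag] N := by
  obtain ⟨hM, top_M⟩ := model_presTOAG_union_tauEq_iff.1 hM
  obtain ⟨hN, top_N⟩ := model_presTOAG_union_tauEq_iff.1 hN
  obtain ⟨_, rfl, _⟩ := exists_truncOps_of_model hM
  obtain ⟨_, rfl, _⟩ := exists_truncOps_of_model hN
  exact elementarilyEquivalent_of_top_eq (realize_tauEq.1 top_M) (realize_tauEq.1 top_N)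

theorem eq_of_models_infiniteResidueTheory (hf : M ⊨ infiniteResidueTheory f)
    (hg : M ⊨ infiniteResidueTheory g) : f = g := by
  obtain ⟨hM, -, hf⟩ := model_infiniteResidueTheory_iff.1 hf
  obtain ⟨-, -, hg⟩ := model_infiniteResidueTheory_iff.1 hg
  obtain ⟨_, rfl, _⟩ := exists_truncOps_of_model hM
  exact eq_of_models_residueAxioms hf hg

theorem eq_of_models_tauEq {m : ℕ} (hn : M ⊨ presTOAG ∪ {tauEq n})
    (hm : M ⊨ presTOAG ∪ {tauEq m}) : n = m := by
  obtain ⟨hM, hn⟩ := model_presTOAG_union_tauEq_iff.1 hn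
  obtain ⟨-, hm⟩ := model_presTOAG_union_tauEq_iff.1 hm
  obtain ⟨_, rfl, _⟩ := exists_truncOps_of_model hM
  exact (nsmul_left_strictMono isPresburgerUnit.pos).injective
    ((realize_tauEq.1 hn).symm.trans (realize_tauEq.1 hm))

theorem infinite_iff_exists_models_infiniteResidueTheory (hM : M ⊨ presTOAG) :
    Infinite M ↔ ∃ f, M ⊨ infiniteResidueTheory f := by
  refine ⟨fun _ => ?_, fun ⟨f, hf⟩ => (model_infiniteResidueTheory_iff.1 hf).2.1⟩
  simp only [model_infiniteResidueTheory_iff, hM, true_and]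
  obtain ⟨_, rfl, _⟩ := exists_truncOps_of_model hM
  obtain ⟨f, hf⟩ := exists_models_residueAxioms (M := M)
  exact ⟨f, ‹_›, hf⟩

theorem finite_iff_exists_models_tauEq (hM : M ⊨ presTOAG) :
    Finite M ↔ ∃ n, 1 ≤ n ∧ M ⊨ presTOAG ∪ {tauEq n} := by
  simp only [model_presTOAG_union_tauEq_iff, hM, true_and]
  obtain ⟨_, rfl, _⟩ := exists_truncOps_of_model hM
  simp only [realize_tauEq]
  refine ⟨fun _ => exists_top_eq_of_finite, fun ⟨n, _, e⟩ => ?_⟩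
  by_contra h
  have := not_finite_iff_infinite.1 h
  exact (nsmul_one_lt_top_of_infinite n).ne' e

end ModelsOfTheories

theorem isComplete_infiniteResidueTheory (f : ZHat) : (infiniteResidueTheory f).IsComplete :=
  Theory.IsComplete.isComplete_iff_models_elementarily_equivalent.2
    ⟨isSatisfiable_infiniteResidueTheory f, fun M N =>
      elementarilyEquivalent_of_models_infiniteResidueTheory M.is_model N.is_model⟩

theorem isComplete_residueAxioms {f : ZHat} (hf : ¬ ∃ n : ℕ, 1 ≤ n ∧ ∀ p, f p = n) :
    (presTOAG ∪ residueAxioms f).IsComplete := by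
  have subset : presTOAG ∪ residueAxioms f ⊆ infiniteResidueTheory f :=
    Set.union_subset_union_left _ Set.subset_union_left
  have model_iff {M : Type} [toag.Structure M] (hM : M ⊨ presTOAG ∪ residueAxioms f) :
      M ⊨ infiniteResidueTheory f :=
    model_infiniteResidueTheory_iff.2 ⟨(Theory.model_union_iff.1 hM).1,
      infinite_of_models_residueAxioms hf hM, (Theory.model_union_iff.1 hM).2⟩
  exact Theory.IsComplete.isComplete_iff_models_elementarily_equivalent.2
    ⟨(isSatisfiable_infiniteResidueTheory f).mono subset, fun M N =>
      elementarilyEquivalent_of_models_infiniteResidueTheory (model_iff M.is_model)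
        (model_iff N.is_model)⟩

theorem isComplete_tauEq {n : ℕ} (hn : 1 ≤ n) : (presTOAG ∪ {tauEq n}).IsComplete := by
  have : NeZero n := ⟨Nat.one_le_iff_ne_zero.1 hn⟩
  have : FinModel n ⊨ presTOAG ∪ {tauEq n} :=
    model_presTOAG_union_tauEq_iff.2 ⟨FinModel.model_presTOAG, FinModel.realize_tauEq_iff.2 rfl⟩
  exact Theory.IsComplete.isComplete_iff_models_elementarily_equivalent.2
    ⟨Theory.Model.isSatisfiable (FinModel n), fun M N =>
      elementarilyEquivalent_of_models_tauEq M.is_model N.is_model⟩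

section Consequences

variable {L : FirstOrder.Language.{0, 0}} {T : L.Theory}

theorem consequences_eq_completeTheory (hT : T.IsComplete) {M : Type} [L.Structure M] [Nonempty M]
    [M ⊨ T] : consequences T = L.completeTheory M :=
  hT.eq_complete_theory M

theorem mem_completions_iff {T' : L.Theory} : T' ∈ completions T ↔
    ∃ (M : Type) (_ : L.Structure M) (_ : Nonempty M), M ⊨ T ∧ T' = L.completeTheory M := by
  constructor
  · rintro ⟨hT, maximal⟩
    obtain ⟨M⟩ := maximal.1
    refine ⟨M, inferInstance, inferInstance, M.is_model.mono hT, ?_⟩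
    rw [← maximal.isComplete.eq_complete_theory M]
    exact Set.ext maximal.mem_iff_models
  · rintro ⟨M, _, _, hM, rfl⟩
    exact ⟨Theory.model_iff_subset_completeTheory.1 hM, completeTheory.isMaximal L M⟩

theorem bijOn_consequences {ι : Type*} {s : Set ι} {S : ι → L.Theory} {R : L.Theory → Prop}
    (complete : ∀ i ∈ s, (S i).IsComplete)
    (unique : ∀ (M : Type) [L.Structure M] (i j), M ⊨ S i → M ⊨ S j → i = j)
    (subset : ∀ i, T ⊆ S i)
    (classify : ∀ (M : Type) [L.Structure M] [Nonempty M], M ⊨ T →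
      (R (L.completeTheory M) ↔ ∃ i ∈ s, M ⊨ S i)) :
    Set.BijOn (fun i => consequences (S i)) s {T' ∈ completions T | R T'} := by
  refine ⟨fun i hi => ?_, fun i hi j _ e => ?_, ?_⟩
  · obtain ⟨M⟩ := (complete i hi).1
    have hM : M ⊨ T := M.is_model.mono (subset i)
    have e : consequences (S i) = L.completeTheory M :=
      consequences_eq_completeTheory (complete i hi)
    exact ⟨mem_completions_iff.2 ⟨M, _, inferInstance, hM, e⟩,
      show R (consequences (S i)) from e ▸ (classify M hM).2 ⟨i, hi, M.is_model⟩⟩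
  · obtain ⟨M⟩ := (complete i hi).1
    have e' : consequences (S j) = L.completeTheory M :=
      e.symm.trans (consequences_eq_completeTheory (complete i hi))
    refine unique M i j M.is_model (Theory.model_iff_subset_completeTheory.2 ?_)
    exact fun φ hφ => e' ▸ Theory.models_sentence_of_mem hφ
  · rintro T' ⟨hT', hR⟩
    obtain ⟨M, _, _, hM, rfl⟩ := mem_completions_iff.1 hT'
    obtain ⟨i, hi, hSM⟩ := (classify M hM).1 hR
    exact ⟨i, hi, consequences_eq_completeTheory (complete i hi)⟩

end Consequences

theorem infiniteTheory_subset_completeTheory_iff {M : Type} [toag.Structure M] [Nonempty M] :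
    toag.infiniteTheory ⊆ toag.completeTheory M ↔ Infinite M := by
  rw [← Theory.model_iff_subset_completeTheory, model_infiniteTheory_iff]

theorem bijOn_infiniteResidueTheory :
    Set.BijOn (fun f : ZHat => consequences (infiniteResidueTheory f)) Set.univ
      {T ∈ completions presTOAG | toag.infiniteTheory ⊆ T} := by
  refine bijOn_consequences (fun f _ => isComplete_infiniteResidueTheory f)
    (fun M _ f g => eq_of_models_infiniteResidueTheory)
    (fun f => Set.subset_union_of_subset_left Set.subset_union_left _) fun M _ _ hM => ?_
  simp only [infiniteTheory_subset_completeTheory_iff, Set.mem_univ, true_and,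
    infinite_iff_exists_models_infiniteResidueTheory hM]

theorem bijOn_tauEq :
    Set.BijOn (fun n : ℕ => consequences (presTOAG ∪ {tauEq n})) {n | 1 ≤ n}
      {T ∈ completions presTOAG | ¬ toag.infiniteTheory ⊆ T} := by
  refine bijOn_consequences (fun n hn => isComplete_tauEq hn)
    (fun M _ n m => eq_of_models_tauEq) (fun n => Set.subset_union_left) fun M _ _ hM => ?_
  rw [infiniteTheory_subset_completeTheory_iff, not_infinite_iff_finite,
    finite_iff_exists_models_tauEq hM]
  rfl

theorem isSatisfiable_presTOAG : presTOAG.IsSatisfiable :=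
  have := FinModel.model_presTOAG (n := 1)
  Theory.Model.isSatisfiable (FinModel 1)

theorem not_isComplete_presTOAG : ¬ presTOAG.IsComplete := by
  intro h
  have := FinModel.model_presTOAG (n := 1)
  have := FinModel.model_presTOAG (n := 2)
  have iff : FinModel 1 ⊨ tauEq 1 ↔ FinModel 2 ⊨ tauEq 1 :=
    (h.realize_sentence_iff _ (FinModel 1)).trans (h.realize_sentence_iff _ (FinModel 2)).symm
  rw [FinModel.realize_tauEq_iff, FinModel.realize_tauEq_iff] at iff
  omega

end TOAG

theorem mainTheorem12 :
    -- model completeness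
    TOAG.IsModelComplete.{u, v} TOAG.presTOAG ∧
    -- consistent but not complete
    (TOAG.presTOAG.IsSatisfiable ∧ ¬ TOAG.presTOAG.IsComplete) ∧
    -- for `f` in the profinite integers, the axioms for infinite models together with
    -- `τ ≡ f(p) (mod p ^ k)` are complete
    (∀ f : TOAG.ZHat,
      (TOAG.presTOAG ∪ TOAG.toag.infiniteTheory ∪ TOAG.residueAxioms f).IsComplete) ∧
    -- and `f ↦` (this theory) is a bijection onto the completions with infinite models
    Set.BijOn
      (fun f : TOAG.ZHat =>
        TOAG.consequences (TOAG.presTOAG ∪ TOAG.toag.infiniteTheory ∪ TOAG.residueAxioms f))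
      Set.univ
      {T ∈ TOAG.completions TOAG.presTOAG | TOAG.toag.infiniteTheory ⊆ T} ∧
    -- unless `f` is a positive integer, the congruences alone are enough
    (∀ f : TOAG.ZHat, (¬ ∃ n : ℕ, 1 ≤ n ∧ ∀ p, f p = n) →
      (TOAG.presTOAG ∪ TOAG.residueAxioms f).IsComplete) ∧
    -- the remaining completions are given by `τ = n`, for `n` a positive integer
    (∀ n : ℕ, 1 ≤ n → (TOAG.presTOAG ∪ {TOAG.tauEq n}).IsComplete) ∧
    Set.BijOn
      (fun n : ℕ => TOAG.consequences (TOAG.presTOAG ∪ {TOAG.tauEq n}))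
      {n | 1 ≤ n}
      {T ∈ TOAG.completions TOAG.presTOAG | ¬ TOAG.toag.infiniteTheory ⊆ T} ∧
    -- quantifier elimination
    TOAG.HasQE TOAG.presTOAGCong :=
  ⟨TOAG.isModelComplete_presTOAG, ⟨TOAG.isSatisfiable_presTOAG, TOAG.not_isComplete_presTOAG⟩,
    TOAG.isComplete_infiniteResidueTheory, TOAG.bijOn_infiniteResidueTheory,
    fun _ => TOAG.isComplete_residueAxioms, fun _ => TOAG.isComplete_tauEq, TOAG.bijOn_tauEq,
    TOAG.hasQE_presTOAGCong⟩
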